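/- Let $2\le d\le 8$, $\nu>0$, $\alpha\ge \frac d4+\frac12$ and $\theta:=1-\frac{d}{4\alpha}$. On the torus $\mathbb T^d=\mathbb R^d/\mathbb Z^d$ let $\mathcal V$ be the set of divergence-free, mean-zero, $\mathbb R^d$-valued trigonometric polynomials, $H$ the closure of $\mathcal V$ in $L^2(\mathbb T^d;\mathbb R^d)$, $P_\sigma$ the orthogonal projection of $L^2$ onto $H$, $A^s:=P_\sigma(-\Delta)^s$, and $B(u,w):=P_\sigma((u\cdot\nabla)w)$. For $s\ge0$ put $$(u,w)_{V^s}:=(A^{s/2}u,A^{s/2}w)_{L^2}=\sum_{k\in\mathbb Z^d}(2\pi|k|)^{2s}\,\hat u_k\cdot\overline{\hat w_k},\qquad \|u\|_{V^s}^2:=(u,u)_{V^s}\qquad(u,w\in H),$$ and let $V^s$ be the set of $u\in H$ with $\|u\|_{V^s}<\infty$; write $\|u\|_V:=\|u\|_{V^1}=\|\nabla u\|_{L^2}$. For a vector field $g\in L^2$ that need not belong to $H$, $\|g\|_{V^s}:=\|P_\sigma(-\Delta)^{s/2}g\|_{L^2}=\|P_\sigma g\|_{V^s}$. A classical solution on $[t_0,\infty)$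 of $u_t+B(u,u)+\nu A^\alpha u=g$ with $u(t_0)=u_0$ is a function $u:[t_0,\infty)\to V^{2\alpha}$ with $u(t_0)=u_0$ that is bounded in $V^{2\alpha}$ on every $[t_0,T]$, is continuous into $H$, and satisfies, for every $\varphi\in\mathcal V$ and every $t\ge t_0$ (with the one-sided derivative at $t_0$), $$\frac{d}{dt}(u,\varphi)_{L^2}+\int_{\mathbb T^d}\big((u\cdot\nabla)u\big)\cdot\varphi\,dx+\nu\,(u,\varphi)_{V^\alpha}=(g,\varphi)_{L^2}.$$ There is a constant $C=C_{\alpha,\nu}>0$, depending only on $d,\alpha,\nu$, such that the following holds. Let $\mu>0$, $h>0$, $c_{0,\alpha}\in\mathbb R$, $t_0\in\mathbb R$, let $I_h$ be a linear map from $L^2(\mathbb T^d;\mathbb R^d)$ to itself (not assumed continuous) with $$\|I_h(\varphi)-\varphi\|_{V^s}^2\le c_{0,\alpha}h^2\|\varphi\|_{V^{s+\alpha}}^2\qquad\text{for all } s\ge0,\ \varphi\in V^{s+\alpha},$$ where the left-hand side is in particular required to be finite. Let $f\in H$ be independent of time, let $u_0,v_0\in V^{2\alpha}$, and let $u$ and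 $v$ be classical solutions on $[t_0,\infty)$ of $$u_t+B(u,u)+\nu A^\alpha u=f,\qquad v_t+B(v,v)+\nu A^\alpha v=f+\mu P_\sigma I_h(u-v),$$ with $u(t_0)=u_0$ and $v(t_0)=v_0$. If $$\mu>2C\,\|u(t)\|_V^{1/\theta}\ \text{ for all } t\ge t_0\qquad\text{and}\qquad \mu h^2c_{0,\alpha}\le\nu,$$ then $\|u-v\|_{L^2}$ decays to $0$ exponentially fast in time: there are $K\in\mathbb R$ and $\lambda>0$ with $$\|u(t)-v(t)\|_{L^2}\le K e^{-\lambda(t-t_0)}\qquad\text{for all } t\ge t_0.$$ -/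

import Mathlib

noncomputable section

namespace FracNSE

open MeasureTheory

/-- The Haar probability measure on the torus `𝕋^d = ℝ^d / ℤ^d`, i.e. Lebesgue measure on
`[0,1]^d`. -/
abbrev torusMeasure (d : ℕ) : Measure (UnitAddTorus (Fin d)) :=
  Measure.pi fun _ => AddCircle.haarAddCircle

/-- The Hilbert space `L²(𝕋^d; ℝ^d)` of square integrable real vector fields. -/
abbrev VField (d : ℕ) : Type := Lp (EuclideanSpace ℝ (Fin d)) 2 (torusMeasure d)

variable {d : ℕ}

/-- The Fourier coefficient `∫ u_i(x) e^{-2π i k·x} dx` of the component `u_i`. -/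
def coeff (u : VField d) (i : Fin d) (k : Fin d → ℤ) : ℂ :=
  UnitAddTorus.mFourierCoeff (fun x => ((u x i : ℝ) : ℂ)) k

/-- `2π|k|`, the symbol of `Λ = (-Δ)^{1/2}` at the wave vector `k`. -/
def waveNumber (k : Fin d → ℤ) : ℝ := 2 * Real.pi * √(∑ i, (k i : ℝ) ^ 2)

/-- The space `𝒱` of vector valued trigonometric polynomials (finitely many nonzero Fourier
coefficients) which are divergence free and have zero mean. -/
def testFields (d : ℕ) : Set (VField d) :=
  {φ | {k : Fin d → ℤ | ∃ i, coeff φ i k ≠ 0}.Finite ∧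
    (∀ k : Fin d → ℤ, ∑ i, (k i : ℂ) * coeff φ i k = 0) ∧
    ∀ i, coeff φ i 0 = 0}

/-- `H`: the closure of `𝒱` in `L²`. -/
def spaceH (d : ℕ) : Submodule ℝ (VField d) :=
  (Submodule.span ℝ (testFields d)).topologicalClosure

instance : CompleteSpace (spaceH d) :=
  inferInstanceAs (CompleteSpace (Submodule.span ℝ (testFields d)).topologicalClosure)

/-- The Leray-Helmholtz projector `P_σ`: the orthogonal projection of `L²` onto `H`. -/
def leray (d : ℕ) : VField d →L[ℝ] VField d := (spaceH d).starProjection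

/-- The inner product `(u, v)_{V^s} = (A^{s/2} u, A^{s/2} v)`, that is
`∑_k (2π|k|)^{2s} û(k) · conj v̂(k)`, for `u, v ∈ V^s`. -/
def vInner (s : ℝ) (u v : VField d) : ℝ :=
  ∑' k : Fin d → ℤ,
    waveNumber k ^ (2 * s) * ∑ i, (coeff u i k * (starRingEnd ℂ) (coeff v i k)).re

/-- The norm of `V^s`; `vNorm 1` is the norm `‖∇u‖_{L²}` of `V`. -/
def vNorm (s : ℝ) (u : VField d) : ℝ := √(vInner s u u)

/-- The space `V^s`, for `s ≥ 0`: the elements of `H` with finite `V^s` norm. -/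
def spaceV (d : ℕ) (s : ℝ) : Set (VField d) :=
  {u | u ∈ spaceH d ∧
    Summable fun k : Fin d → ℤ => waveNumber k ^ (2 * s) * ∑ i, ‖coeff u i k‖ ^ 2}

/-- The weak partial derivative `∂v_j/∂x_i` of `v ∈ V`, as the sum in `L²` of the Fourier series
`∑_k 2π i k_i v̂_j(k) e^{2π i k·x}`. -/
def partialDeriv (i j : Fin d) (v : VField d) : Lp ℂ 2 (torusMeasure d) :=
  ∑' k : Fin d → ℤ,
    (2 * (Real.pi : ℂ) * Complex.I * (k i : ℂ) * coeff v j k) • UnitAddTorus.mFourierLp 2 k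

/-- The trilinear form `b(u, v, w) = ∫ ((u·∇)v)·w dx`. The integrand is real valued: the real part
only serves to land in `ℝ`. -/
def triForm (u v w : VField d) : ℝ :=
  (∫ x, ∑ i, ∑ j, ((u x i : ℝ) : ℂ) * partialDeriv i j v x * ((w x j : ℝ) : ℂ)
    ∂(torusMeasure d)).re

/-- `u` is a classical solution on `[t₀, ∞)` of
`u_t + B(u, u) + ν A^α u = g`, `u(t₀) = u₀`.
The function `u : [t₀, ∞) → V^{2α}` is locally bounded in `V^{2α}` and continuous in `H`
(whence it is continuous in `V^s` for all `s < 2α`), and the equation holds at every time when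
tested against the elements of `𝒱`. The values `u t` for `t < t₀` play no role. -/
structure IsClassicalSolution (α ν t₀ : ℝ) (g : ℝ → VField d) (u₀ : VField d)
    (u : ℝ → VField d) : Prop where
  init : u t₀ = u₀
  mem : ∀ t, t₀ ≤ t → u t ∈ spaceV d (2 * α)
  bounded : ∀ T, ∃ M : ℝ, ∀ t ∈ Set.Icc t₀ T, vNorm (2 * α) (u t) ≤ M
  continuousOn : ContinuousOn u (Set.Ici t₀)
  equation : ∀ φ ∈ testFields d, ∀ t, t₀ ≤ t →
    HasDerivWithinAt (fun τ => inner ℝ (u τ) φ)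
      (inner ℝ (g t) φ - triForm (u t) (u t) φ - ν * vInner α (u t) φ) (Set.Ici t₀) t

/-- The interpolation inequality `‖I_h(φ) - φ‖²_{V^s} ≤ c h² ‖φ‖²_{V^{s+α}}` for all `s ≥ 0` and
`φ ∈ V^{s+α}`. As `‖g‖_{V^s} = ‖P_σ (-Δ)^{s/2} g‖_{L²} = ‖(-Δ)^{s/2} P_σ g‖_{L²}`, only the
component of `I_h(φ) - φ` in `H` enters, and `I_h(φ)` itself need not be divergence free or of mean
zero. -/
def IsInterpolant (α h c : ℝ) (I : VField d →ₗ[ℝ] VField d) : Prop :=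
  ∀ s : ℝ, 0 ≤ s → ∀ φ ∈ spaceV d (s + α),
    leray d (I φ - φ) ∈ spaceV d s ∧
      vNorm s (leray d (I φ - φ)) ^ 2 ≤ c * h ^ 2 * vNorm (s + α) φ ^ 2

end FracNSE

end

open FracNSE

/-!
# Exponential synchronisation of nudged fractional Navier-Stokes flows

Put `w = u - v`. Subtracting the two equations and testing with `w` gives, since `b(v, w, w) = 0`,
`½ d/dt ‖w‖² = -μ (P_σ I_h w, w) - b(w, u, w) - ν ‖w‖²_{V^α}`.
The interpolation inequality at `s = 0`, with `μ h² c₀ ≤ ν`, shows that the nudging term is at most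
`-(μ/2) ‖w‖² + (ν/2) ‖w‖²_{V^α}`. The trilinear term satisfies
`|b(w, u, w)| ≤ (ν/4) ‖w‖²_{V^α} + C ‖u‖_V^{1/θ} ‖w‖²`. As `μ > 2 C ‖u‖_V^{1/θ}`, what remains is
`½ d/dt ‖w‖² ≤ -(ν/4) ‖w‖²_{V^α} ≤ -(ν/4) ‖w‖²` by the Poincaré inequality (`energy_rate_le`), so the
decay rate comes from the dissipation, and no uniform gap in the lower bound on `μ` is needed.

The work lies in two places.

* The trilinear form. Fields in `V^{2α}` have absolutely summable Fourier coefficients, as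
  `4α > d`, so `b(u, v, w)` equals the convolution sum
  `∑_{k,j} (û(k) · 2πi j) (v̂(j) · conj ŵ(k + j))` (`triForm_eq_re_tsum`). An involution of the
  frequencies yields `b(v, w, w) = 0` (`triForm_self_eq_zero`). For the estimate, weight `ŵ(k)` by
  `(1 + (2π|k|/R)^{2α})^{1/2}` and apply the Cauchy-Schwarz inequality; since
  `∑_k (1 + (2π|k|/R)^{2α})^{-2} = O(R^d)`, this gives
  `|b(w, u, w)| ≤ C R^{d/2} ‖u‖_V (‖w‖² + R^{-2α} ‖w‖²_{V^α})` (`exists_abs_triForm_le`), and the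
  choice of `R` produces the exponent `1/θ` (`exists_abs_triForm_le_dissipation`).

* The energy identity. The equation holds only when tested with trigonometric polynomials, and `I_h`
  is not continuous. But for `u ∈ V^{2α}` the right-hand side is a bounded functional on `L²`, with
  norm bounded locally in time (`exists_clm_rhs`); for `P_σ I_h w` this is the interpolation
  inequality again. Hence `w` is Lipschitz in `L²`, and `‖w‖²` is differentiable at every time
  (`hasDerivWithinAt_norm_sq_of_weak_deriv`).
-/

noncomputable section

namespace FracNSE

open MeasureTheory

open scoped ComplexConjugate

/-! ### Inequalities for sums over a lattice -/

/-- The Cauchy-Schwarz inequality for infinite sums. -/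
theorem summable_mul_and_tsum_mul_le_sqrt_mul_sqrt {ι : Type*} {f g : ι → ℝ} (hf0 : ∀ i, 0 ≤ f i)
    (hg0 : ∀ i, 0 ≤ g i) (hf : Summable fun i => f i ^ 2) (hg : Summable fun i => g i ^ 2) :
    (Summable fun i => f i * g i) ∧
      ∑' i, f i * g i ≤ √(∑' i, f i ^ 2) * √(∑' i, g i ^ 2) := by
  have hf' : Summable fun i => f i ^ (2 : ℝ) := by simpa using hf
  have hg' : Summable fun i => g i ^ (2 : ℝ) := by simpa using hg
  simpa [Real.sqrt_eq_rpow] using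
    Real.summable_and_inner_le_Lp_mul_Lq_tsum_of_nonneg Real.HolderConjugate.two_two hf0 hg0
      hf' hg'

section Convolution

variable {G : Type*} [AddCommGroup G]

/-- The bijection `(k, j) ↦ (k, k + j)`. -/
def shearEquiv (G : Type*) [AddCommGroup G] : G × G ≃ G × G where
  toFun p := (p.1, p.1 + p.2)
  invFun p := (p.1, p.2 - p.1)
  left_inv p := by simp
  right_inv p := by simp

/-- The bijection `(k, j) ↦ (k + j, j)`. -/
def shearEquiv' (G : Type*) [AddCommGroup G] : G × G ≃ G × G where
  toFun p := (p.1 + p.2, p.2)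
  invFun p := (p.1 - p.2, p.2)
  left_inv p := by simp
  right_inv p := by simp

/-- The involution `(k, j) ↦ (-k, k + j)`. -/
def flipEquiv (G : Type*) [AddCommGroup G] : G × G ≃ G × G where
  toFun p := (-p.1, p.1 + p.2)
  invFun p := (-p.1, p.1 + p.2)
  left_inv p := by simp
  right_inv p := by simp

theorem hasSum_mul_prod {ι κ : Type*} {f : ι → ℝ} {g : κ → ℝ} (hf0 : ∀ i, 0 ≤ f i)
    (hg0 : ∀ i, 0 ≤ g i) (hf : Summable f) (hg : Summable g) :
    HasSum (fun p : ι × κ => f p.1 * g p.2) ((∑' i, f i) * ∑' i, g i) :=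
  hf.hasSum.mul hg.hasSum (hf.mul_of_nonneg hg hf0 hg0)

/-- A weighted form of Young's convolution inequality `ℓ² × ℓ^{4/3} × ℓ^{4/3}`: the fourth powers
of the weight `n` are summable, and `B` is square summable. -/
theorem summable_and_tsum_conv_le {a B n : G → ℝ} (ha0 : ∀ k, 0 ≤ a k) (hB0 : ∀ k, 0 ≤ B k)
    (hn0 : ∀ k, 0 ≤ n k) (ha : Summable fun k => a k ^ 2) (hB : Summable fun k => B k ^ 2)
    (hn : Summable fun k => n k ^ 4) :
    (Summable fun p : G × G => (B p.1 * n p.1) * a p.2 * (B (p.1 + p.2) * n (p.1 + p.2))) ∧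
      ∑' p : G × G, (B p.1 * n p.1) * a p.2 * (B (p.1 + p.2) * n (p.1 + p.2)) ≤
        (∑' k, B k ^ 2) * (√(∑' k, a k ^ 2) * √(∑' k, n k ^ 4)) := by
  have h1 : HasSum (fun p : G × G => (B p.1 * B (p.1 + p.2)) ^ 2)
      ((∑' k, B k ^ 2) * ∑' k, B k ^ 2) := by
    have := (shearEquiv G).hasSum_iff.2
      (hasSum_mul_prod (fun k => sq_nonneg (B k)) (fun k => sq_nonneg (B k)) hB hB)
    refine this.congr_fun fun p => ?_
    simp [shearEquiv, mul_pow]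
  have h4 : ∀ k, 0 ≤ n k ^ 4 := fun k => by positivity
  have h2 : HasSum (fun p : G × G => n p.1 ^ 4 * a p.2 ^ 2)
      ((∑' k, n k ^ 4) * ∑' k, a k ^ 2) :=
    hasSum_mul_prod h4 (fun k => sq_nonneg (a k)) hn ha
  have h3 : HasSum (fun p : G × G => n (p.1 + p.2) ^ 4 * a p.2 ^ 2)
      ((∑' k, n k ^ 4) * ∑' k, a k ^ 2) := (shearEquiv' G).hasSum_iff.2 h2
  have h5 := (h2.add h3).mul_left (1 / 2)
  have hle : ∀ p : G × G, (a p.2 * (n p.1 * n (p.1 + p.2))) ^ 2 ≤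
      1 / 2 * (n p.1 ^ 4 * a p.2 ^ 2 + n (p.1 + p.2) ^ 4 * a p.2 ^ 2) := fun p => by
    nlinarith [mul_nonneg (sq_nonneg (a p.2)) (sq_nonneg (n p.1 ^ 2 - n (p.1 + p.2) ^ 2))]
  have h6 : Summable fun p : G × G => (a p.2 * (n p.1 * n (p.1 + p.2))) ^ 2 :=
    Summable.of_nonneg_of_le (fun _ => sq_nonneg _) hle h5.summable
  have h7 := (h6.tsum_le_tsum hle h5.summable).trans_eq h5.tsum_eq
  have hcs := summable_mul_and_tsum_mul_le_sqrt_mul_sqrt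
    (f := fun p : G × G => B p.1 * B (p.1 + p.2))
    (g := fun p : G × G => a p.2 * (n p.1 * n (p.1 + p.2)))
    (fun p => mul_nonneg (hB0 _) (hB0 _))
    (fun p => mul_nonneg (ha0 _) (mul_nonneg (hn0 _) (hn0 _))) h1.summable h6
  have heq : (fun p : G × G => (B p.1 * n p.1) * a p.2 * (B (p.1 + p.2) * n (p.1 + p.2))) =
      fun p => (B p.1 * B (p.1 + p.2)) * (a p.2 * (n p.1 * n (p.1 + p.2))) := by
    funext p; ring
  rw [heq]
  refine ⟨hcs.1, hcs.2.trans ?_⟩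
  rw [h1.tsum_eq, Real.sqrt_mul_self (tsum_nonneg fun k => sq_nonneg (B k))]
  refine mul_le_mul_of_nonneg_left ?_ (tsum_nonneg fun k => sq_nonneg (B k))
  rw [← Real.sqrt_mul (tsum_nonneg fun k => sq_nonneg (a k))]
  exact Real.sqrt_le_sqrt (h7.trans_eq (by ring))

/-- The elementary bound for an `ℓ¹ × ℓ² × ℓ²` convolution. -/
theorem summable_and_tsum_conv_le_of_summable {a b c : G → ℝ} (ha0 : ∀ k, 0 ≤ a k)
    (hb0 : ∀ k, 0 ≤ b k) (hc0 : ∀ k, 0 ≤ c k) (ha : Summable a) (hb : Summable fun k => b k ^ 2)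
    (hc : Summable fun k => c k ^ 2) :
    (Summable fun p : G × G => a p.1 * b p.2 * c (p.1 + p.2)) ∧
      ∑' p : G × G, a p.1 * b p.2 * c (p.1 + p.2) ≤
        (∑' k, a k) * (√(∑' k, b k ^ 2) * √(∑' k, c k ^ 2)) := by
  have hcs : ∀ k, (Summable fun j => b j * c (k + j)) ∧
      ∑' j, b j * c (k + j) ≤ √(∑' k, b k ^ 2) * √(∑' k, c k ^ 2) := fun k => by
    have := summable_mul_and_tsum_mul_le_sqrt_mul_sqrt (f := b) (g := fun j => c (k + j)) hb0
      (fun _ => hc0 _) hb ((Equiv.addLeft k).summable_iff (f := fun j => c j ^ 2) |>.2 hc)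
    have h := (Equiv.addLeft k).tsum_eq fun j => c j ^ 2
    simp only [Equiv.coe_addLeft] at h
    rwa [h] at this
  have hs : Summable fun k => ∑' j, a k * b j * c (k + j) := by
    refine Summable.of_nonneg_of_le
      (fun k => tsum_nonneg fun j => mul_nonneg (mul_nonneg (ha0 _) (hb0 _)) (hc0 _)) (fun k => ?_)
      (ha.mul_right (√(∑' k, b k ^ 2) * √(∑' k, c k ^ 2)))
    simp only [mul_assoc, tsum_mul_left]
    simpa only [mul_assoc] using mul_le_mul_of_nonneg_left (hcs k).2 (ha0 k)
  have hp : Summable fun p : G × G => a p.1 * b p.2 * c (p.1 + p.2) := by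
    refine (summable_prod_of_nonneg
      fun p => mul_nonneg (mul_nonneg (ha0 _) (hb0 _)) (hc0 _)).2 ⟨fun k => ?_, hs⟩
    simpa only [mul_assoc] using (hcs k).1.mul_left (a k)
  refine ⟨hp, ?_⟩
  rw [hp.tsum_prod, ← tsum_mul_right]
  refine hs.tsum_le_tsum (fun k => ?_) (ha.mul_right _)
  simp only [mul_assoc, tsum_mul_left]
  simpa only [mul_assoc] using mul_le_mul_of_nonneg_left (hcs k).2 (ha0 k)

end Convolution

/-! ### The number of lattice points below a given frequency -/

theorem summable_prod_apply_and_tsum_le {ι : Type*} {d : ℕ} {f : ι → ℝ} (hf0 : ∀ i, 0 ≤ f i)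
    {S : ℝ} (hf : ∀ t : Finset ι, ∑ i ∈ t, f i ≤ S) :
    (Summable fun k : Fin d → ι => ∏ i, f (k i)) ∧ ∑' k : Fin d → ι, ∏ i, f (k i) ≤ S ^ d := by
  classical
  have hbd : ∀ s : Finset (Fin d → ι), ∑ k ∈ s, ∏ i, f (k i) ≤ S ^ d := fun s => by
    have hsub : s ⊆ Fintype.piFinset fun i => s.image fun k => k i := fun k hk =>
      Fintype.mem_piFinset.2 fun i => Finset.mem_image_of_mem _ hk
    calc ∑ k ∈ s, ∏ i, f (k i)
        ≤ ∑ k ∈ Fintype.piFinset fun i => s.image fun k => k i, ∏ i, f (k i) :=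
          Finset.sum_le_sum_of_subset_of_nonneg hsub
            fun _ _ _ => Finset.prod_nonneg fun i _ => hf0 _
      _ = ∏ i : Fin d, ∑ n ∈ s.image fun k => k i, f n := (Finset.prod_univ_sum _ _).symm
      _ ≤ ∏ _i : Fin d, S :=
          Finset.prod_le_prod (fun _ _ => Finset.sum_nonneg fun _ _ => hf0 _) fun _ _ => hf _
      _ = S ^ d := by simp
  have h0 : ∀ k : Fin d → ι, 0 ≤ ∏ i, f (k i) := fun k => Finset.prod_nonneg fun i _ => hf0 _
  exact ⟨summable_of_sum_le h0 hbd, Real.tsum_le_of_sum_le h0 hbd⟩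

theorem exists_sum_one_add_div_rpow_le {p : ℝ} (hp : 1 < p) :
    ∃ S : ℝ, 0 < S ∧ ∀ R : ℝ, 1 ≤ R → ∀ t : Finset ℤ,
      ∑ n ∈ t, (1 + |(n : ℝ)| / R) ^ (-p) ≤ S * R := by
  have hz : Summable fun q : ℕ => (1 + (q : ℝ)) ^ (-p) := by
    have := (summable_nat_add_iff 1).2 (Real.summable_nat_rpow.2 (neg_lt_neg hp))
    refine this.congr fun q => ?_
    push_cast; rw [add_comm]
  set Z := ∑' q : ℕ, (1 + (q : ℝ)) ^ (-p) with hZ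
  have hq0 : ∀ q : ℕ, 0 ≤ (1 + (q : ℝ)) ^ (-p) := fun q => by positivity
  have hZ0 : 0 < Z := hz.tsum_pos hq0 0 (by simp)
  refine ⟨4 * Z, by positivity, fun R hR t => ?_⟩
  have hR0 : 0 < R := by linarith
  set N := ⌈R⌉₊ with hN
  have hNR : R ≤ N := Nat.le_ceil R
  have hN2 : (N : ℝ) ≤ 2 * R := by linarith [Nat.ceil_lt_add_one hR0.le]
  have hN0 : N ≠ 0 := by
    rintro h; rw [h] at hNR; norm_num at hNR; linarith
  have : NeZero N := ⟨hN0⟩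
  have hNpos : (0 : ℝ) < N := by linarith
  -- the integers `n` with `|n| / N` in `[q, q + 1)` contribute at most `(1 + q)^{-p}` each
  have hle : ∀ n : ℕ, (1 + (n : ℝ) / R) ^ (-p) ≤ (1 + ((n / N : ℕ) : ℝ)) ^ (-p) := fun n => by
    refine Real.rpow_le_rpow_of_nonpos (by positivity) ?_ (by linarith)
    have h1 : ((n / N : ℕ) : ℝ) ≤ (n : ℝ) / N := Nat.cast_div_le
    have h2 : (n : ℝ) / N ≤ n / R := by gcongr
    linarith
  have hblock : HasSum (fun n : ℕ => (1 + ((n / N : ℕ) : ℝ)) ^ (-p)) (Z * N) := by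
    have h := hasSum_mul_prod (g := fun _ : Fin N => (1 : ℝ)) hq0 (fun _ => zero_le_one) hz
      (hasSum_fintype _).summable
    have h' := (Nat.divModEquiv N).hasSum_iff.2 h
    simpa [Function.comp_def, Nat.divModEquiv] using h'
  have hs : Summable fun n : ℕ => (1 + (n : ℝ) / R) ^ (-p) :=
    Summable.of_nonneg_of_le (fun n => by positivity) hle hblock.summable
  have hsum : ∑' n : ℕ, (1 + (n : ℝ) / R) ^ (-p) ≤ 2 * Z * R := by
    refine (hs.tsum_le_tsum hle hblock.summable).trans ?_
    rw [hblock.tsum_eq]; nlinarith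
  have hs' : HasSum (fun n : ℕ => (1 + |((n : ℤ) : ℝ)| / R) ^ (-p))
      (∑' n : ℕ, (1 + (n : ℝ) / R) ^ (-p)) := by
    simpa using hs.hasSum
  have hs1 : HasSum (fun n : ℕ => (1 + |((-((n : ℤ) + 1) : ℤ) : ℝ)| / R) ^ (-p))
      (∑' n : ℕ, (1 + ((n + 1 : ℕ) : ℝ) / R) ^ (-p)) := by
    refine ((summable_nat_add_iff 1).2 hs).hasSum.congr_fun fun n => ?_
    have : |((-((n : ℤ) + 1) : ℤ) : ℝ)| = ((n + 1 : ℕ) : ℝ) := by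
      push_cast
      rw [abs_neg, abs_of_nonneg (by positivity)]
    rw [this]
  have hZs := HasSum.of_nat_of_neg_add_one (f := fun n : ℤ => (1 + |(n : ℝ)| / R) ^ (-p)) hs' hs1
  have h1 : ∑' n : ℕ, (1 + ((n + 1 : ℕ) : ℝ) / R) ^ (-p) ≤ ∑' n : ℕ, (1 + (n : ℝ) / R) ^ (-p) := by
    rw [hs.tsum_eq_zero_add]
    have : 0 ≤ (1 + ((0 : ℕ) : ℝ) / R) ^ (-p) := by positivity
    linarith
  calc ∑ n ∈ t, (1 + |(n : ℝ)| / R) ^ (-p)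
      ≤ _ := sum_le_hasSum t (fun n _ => by positivity) hZs
    _ ≤ 4 * Z * R := by linarith

theorem waveNumber_nonneg {d : ℕ} (k : Fin d → ℤ) : 0 ≤ waveNumber k := by
  unfold waveNumber; positivity

theorem abs_le_waveNumber {d : ℕ} (k : Fin d → ℤ) (i : Fin d) : |(k i : ℝ)| ≤ waveNumber k := by
  have h1 : |(k i : ℝ)| ≤ √(∑ i, (k i : ℝ) ^ 2) :=
    Real.abs_le_sqrt (Finset.single_le_sum (f := fun i => (k i : ℝ) ^ 2)
      (fun _ _ => sq_nonneg _) (Finset.mem_univ i))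
  have h2 : 1 ≤ 2 * Real.pi := by linarith [Real.pi_gt_three]
  exact h1.trans (le_mul_of_one_le_left (Real.sqrt_nonneg _) h2)

theorem one_le_waveNumber {d : ℕ} {k : Fin d → ℤ} (hk : k ≠ 0) : 1 ≤ waveNumber k := by
  obtain ⟨i, hi⟩ := Function.ne_iff.1 hk
  refine le_trans ?_ (abs_le_waveNumber k i)
  exact_mod_cast Int.one_le_abs hi

/-- The weight `1 + (2π|k|/R)^{2α}`, comparable to `1` for frequencies below `R` and to the symbol
of `R^{-2α} A^α` above. -/
def weight {d : ℕ} (α R : ℝ) (k : Fin d → ℤ) : ℝ := 1 + (waveNumber k / R) ^ (2 * α)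

theorem one_le_weight {d : ℕ} (α : ℝ) {R : ℝ} (hR : 0 ≤ R) (k : Fin d → ℤ) :
    1 ≤ weight α R k := by
  have := Real.rpow_nonneg (div_nonneg (waveNumber_nonneg k) hR) (2 * α)
  unfold weight; linarith

/-- The frequencies below `R` number `O(R^d)`, and since `4α > d` those above `R` do not matter:
`∑_k (1 + (2π|k|/R)^{2α})^{-2} = O(R^d)`. -/
theorem exists_tsum_weight_le {d : ℕ} (hd : 0 < d) {α : ℝ} (hα : (d : ℝ) < 4 * α) :
    ∃ S : ℝ, 0 < S ∧ ∀ R : ℝ, 1 ≤ R →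
      (Summable fun k : Fin d → ℤ => (weight α R k ^ 2)⁻¹) ∧
        ∑' k : Fin d → ℤ, (weight α R k ^ 2)⁻¹ ≤ S * R ^ d := by
  have hd' : (0 : ℝ) < d := by exact_mod_cast hd
  have hα0 : 0 < α := by linarith
  obtain ⟨S, hS0, hS⟩ := exists_sum_one_add_div_rpow_le (p := 4 * α / d) ((one_lt_div hd').2 hα)
  refine ⟨2 ^ (4 * α) * S ^ d, by positivity, fun R hR => ?_⟩
  have hR0 : 0 < R := by linarith
  obtain ⟨hs, hle⟩ := summable_prod_apply_and_tsum_le (d := d)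
    (f := fun n : ℤ => (1 + |(n : ℝ)| / R) ^ (-(4 * α / d))) (fun n => by positivity) (hS R hR)
  have hpt : ∀ k : Fin d → ℤ, (weight α R k ^ 2)⁻¹ ≤
      2 ^ (4 * α) * ∏ i, (1 + |(k i : ℝ)| / R) ^ (-(4 * α / d)) := fun k => by
    set y := waveNumber k / R with hy
    have hy0 : 0 ≤ y := div_nonneg (waveNumber_nonneg k) hR0.le
    have hw : 0 < weight α R k := zero_lt_one.trans_le (one_le_weight α hR0.le k)
    have h1 : (1 + y) ^ (2 * α) ≤ 2 ^ (2 * α) * weight α R k := by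
      have hyα : 0 ≤ y ^ (2 * α) := Real.rpow_nonneg hy0 _
      have h2α : (0 : ℝ) ≤ 2 ^ (2 * α) := by positivity
      rcases le_total y 1 with h | h
      · calc (1 + y) ^ (2 * α) ≤ 2 ^ (2 * α) := by gcongr; linarith
          _ ≤ 2 ^ (2 * α) * weight α R k :=
            le_mul_of_one_le_right h2α (one_le_weight α hR0.le k)
      · calc (1 + y) ^ (2 * α) ≤ (2 * y) ^ (2 * α) := by gcongr; linarith
          _ = 2 ^ (2 * α) * y ^ (2 * α) := Real.mul_rpow (by norm_num) hy0
          _ ≤ 2 ^ (2 * α) * weight α R k := by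
            gcongr; unfold weight; rw [← hy]; linarith
    have h2 : ∏ i : Fin d, (1 + y) ^ (-(4 * α / d)) ≤
        ∏ i, (1 + |(k i : ℝ)| / R) ^ (-(4 * α / d)) := by
      refine Finset.prod_le_prod (fun _ _ => by positivity) fun i _ => ?_
      refine Real.rpow_le_rpow_of_nonpos (by positivity) ?_ ?_
      · have := div_le_div_of_nonneg_right (abs_le_waveNumber k i) hR0.le
        linarith
      · have : 0 < 4 * α / d := by positivity
        linarith
    have h3 : ∏ i : Fin d, (1 + y) ^ (-(4 * α / d)) = (((1 + y) ^ (2 * α)) ^ 2)⁻¹ := by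
      rw [Finset.prod_const, Finset.card_univ, Fintype.card_fin, ← Real.rpow_natCast,
        ← Real.rpow_natCast, ← Real.rpow_mul (by positivity), ← Real.rpow_mul (by positivity),
        ← Real.rpow_neg (by positivity)]
      congr 1
      push_cast
      field_simp
      ring
    have h4 : (2 : ℝ) ^ (4 * α) = (2 ^ (2 * α)) ^ 2 := by
      rw [← Real.rpow_natCast, ← Real.rpow_mul (by norm_num)]
      congr 1; push_cast; ring
    have h5 : (weight α R k ^ 2)⁻¹ ≤ 2 ^ (4 * α) * (((1 + y) ^ (2 * α)) ^ 2)⁻¹ := by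
      rw [h4, ← div_eq_mul_inv, inv_eq_one_div, div_le_div_iff₀ (by positivity) (by positivity),
        one_mul, ← mul_pow]
      gcongr
    exact h5.trans (mul_le_mul_of_nonneg_left (h3 ▸ h2) (by positivity))
  have hsum : Summable fun k : Fin d → ℤ => (weight α R k ^ 2)⁻¹ :=
    Summable.of_nonneg_of_le (fun k => by positivity) hpt (hs.mul_left _)
  refine ⟨hsum, (hsum.tsum_le_tsum hpt (hs.mul_left _)).trans ?_⟩
  rw [tsum_mul_left, mul_assoc, ← mul_pow]
  gcongr

variable {d : ℕ}

/-! ### Fourier series of square integrable fields -/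

/-- The `i`-th component of a real vector field, as an element of complex `L²`. -/
def comp (i : Fin d) : VField d →L[ℝ] Lp ℂ 2 (torusMeasure d) :=
  (Complex.ofRealCLM.comp (EuclideanSpace.proj i)).compLpL 2 (torusMeasure d)

theorem coeFn_comp (i : Fin d) (u : VField d) :
    comp i u =ᵐ[torusMeasure d] fun x => ((u x i : ℝ) : ℂ) :=
  (Complex.ofRealCLM.comp (EuclideanSpace.proj i)).coeFn_compLpL u

theorem conj_comp (i : Fin d) (u : VField d) :
    ∀ᵐ x ∂torusMeasure d, conj (comp i u x) = comp i u x := by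
  filter_upwards [coeFn_comp i u] with x hx
  rw [hx, Complex.conj_ofReal]

/-- The Fourier orthonormal basis of complex `L²` of the torus. -/
def basis (d : ℕ) : HilbertBasis (Fin d → ℤ) ℂ (Lp ℂ 2 (torusMeasure d)) :=
  UnitAddTorus.mFourierBasis

theorem basis_apply (k : Fin d → ℤ) : basis d k = UnitAddTorus.mFourierLp 2 k := by
  unfold basis; rw [UnitAddTorus.coe_mFourierBasis]

/-- The Fourier coefficients of an element of complex `L²`. -/
def hat (f : Lp ℂ 2 (torusMeasure d)) (k : Fin d → ℤ) : ℂ := (basis d).repr f k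

theorem hat_eq_integral (f : Lp ℂ 2 (torusMeasure d)) (k : Fin d → ℤ) :
    hat f k = ∫ x, UnitAddTorus.mFourier (-k) x * f x ∂torusMeasure d :=
  UnitAddTorus.mFourierBasis_repr f k

theorem hasSum_hat_smul (f : Lp ℂ 2 (torusMeasure d)) :
    HasSum (fun k => hat f k • basis d k) f := (basis d).hasSum_repr f

theorem hasSum_hat_mul_conj (f g : Lp ℂ 2 (torusMeasure d)) :
    HasSum (fun k => hat g k * conj (hat f k)) (inner ℂ f g) := by
  refine ((basis d).hasSum_inner_mul_inner f g).congr_fun fun k => ?_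
  unfold hat
  rw [HilbertBasis.repr_apply_apply, HilbertBasis.repr_apply_apply, inner_conj_symm, mul_comm]

theorem hasSum_norm_hat_sq (f : Lp ℂ 2 (torusMeasure d)) :
    HasSum (fun k => ‖hat f k‖ ^ 2) (‖f‖ ^ 2) := by
  have h := RCLike.hasSum_re ℂ (hasSum_hat_mul_conj f f)
  rw [inner_self_eq_norm_sq] at h
  refine h.congr_fun fun k => ?_
  rw [RCLike.mul_conj, ← RCLike.ofReal_pow, RCLike.ofReal_re]

theorem coeff_eq_hat (u : VField d) (i : Fin d) (k : Fin d → ℤ) :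
    coeff u i k = hat (comp i u) k := by
  rw [hat_eq_integral]
  unfold coeff UnitAddTorus.mFourierCoeff
  refine integral_congr_ae (μ := torusMeasure d) ?_
  filter_upwards [coeFn_comp i u] with x hx
  rw [hx, smul_eq_mul]

theorem coeff_sub (u v : VField d) (i : Fin d) (k : Fin d → ℤ) :
    coeff (u - v) i k = coeff u i k - coeff v i k := by
  simp [coeff_eq_hat, hat]

theorem coeff_add (u v : VField d) (i : Fin d) (k : Fin d → ℤ) :
    coeff (u + v) i k = coeff u i k + coeff v i k := by
  simp [coeff_eq_hat, hat]

theorem coeff_smul (c : ℝ) (u : VField d) (i : Fin d) (k : Fin d → ℤ) :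
    coeff (c • u) i k = c * coeff u i k := by
  rw [coeff_eq_hat, coeff_eq_hat, map_smul, hat, hat, HilbertBasis.repr_apply_apply,
    HilbertBasis.repr_apply_apply, inner_smul_right_eq_smul, Complex.real_smul]

theorem continuous_coeff (i : Fin d) (k : Fin d → ℤ) : Continuous fun u : VField d => coeff u i k := by
  simp only [coeff_eq_hat, hat, HilbertBasis.repr_apply_apply]
  fun_prop

theorem coeff_neg_freq (u : VField d) (i : Fin d) (k : Fin d → ℤ) :
    coeff u i (-k) = conj (coeff u i k) := by
  rw [coeff_eq_hat, coeff_eq_hat, hat_eq_integral, hat_eq_integral, ← integral_conj]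
  refine integral_congr_ae ?_
  filter_upwards [conj_comp i u] with x hx
  rw [map_mul, hx, UnitAddTorus.mFourier_neg, UnitAddTorus.mFourier_neg]

theorem inner_eq_sum_comp (u v : VField d) :
    inner ℝ u v = ∑ i, (inner ℂ (comp i v) (comp i u)).re := by
  have h : ∀ i, inner ℂ (comp i v) (comp i u) =
      ((∫ x, u x i * v x i ∂torusMeasure d : ℝ) : ℂ) := fun i => by
    rw [L2.inner_def]
    refine Eq.trans (integral_congr_ae ?_) (integral_ofReal (𝕜 := ℂ))
    filter_upwards [coeFn_comp i u, coeFn_comp i v] with x hu hv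
    rw [hu, hv]
    simp
  have hint : ∀ i, Integrable (fun x => u x i * v x i) (torusMeasure d) := fun i => by
    have := (L2.integrable_inner (𝕜 := ℂ) (comp i v) (comp i u)).re
    refine this.congr ?_
    filter_upwards [coeFn_comp i u, coeFn_comp i v] with x hu hv
    rw [hu, hv]
    simp
  simp_rw [h, Complex.ofReal_re]
  rw [L2.inner_def, ← integral_finsetSum _ fun i _ => hint i]
  refine integral_congr_ae (Filter.Eventually.of_forall fun x => ?_)
  simp [PiLp.inner_apply, mul_comm]

/-- Parseval's identity for vector fields. -/
theorem hasSum_coeff_mul_conj (u v : VField d) :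
    HasSum (fun k => ∑ i, (coeff u i k * conj (coeff v i k)).re) (inner ℝ u v) := by
  rw [inner_eq_sum_comp]
  refine hasSum_sum fun i _ => ?_
  simp only [coeff_eq_hat]
  exact Complex.hasSum_re (hasSum_hat_mul_conj (comp i v) (comp i u))

/-- The Euclidean length of the vector `û(k)`. -/
def amp (u : VField d) (k : Fin d → ℤ) : ℝ := √(∑ i, ‖coeff u i k‖ ^ 2)

theorem amp_nonneg (u : VField d) (k : Fin d → ℤ) : 0 ≤ amp u k := Real.sqrt_nonneg _

theorem amp_sq (u : VField d) (k : Fin d → ℤ) : amp u k ^ 2 = ∑ i, ‖coeff u i k‖ ^ 2 :=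
  Real.sq_sqrt (by positivity)

theorem norm_coeff_le_amp (u : VField d) (i : Fin d) (k : Fin d → ℤ) : ‖coeff u i k‖ ≤ amp u k :=
  Real.le_sqrt_of_sq_le (Finset.single_le_sum (f := fun i => ‖coeff u i k‖ ^ 2)
    (fun _ _ => sq_nonneg _) (Finset.mem_univ i))

theorem sum_re_mul_conj_self (u : VField d) (k : Fin d → ℤ) :
    ∑ i, (coeff u i k * conj (coeff u i k)).re = amp u k ^ 2 := by
  rw [amp_sq]
  refine Finset.sum_congr rfl fun i _ => ?_
  rw [Complex.mul_conj, Complex.ofReal_re, Complex.normSq_eq_norm_sq]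

theorem hasSum_amp_sq (u : VField d) : HasSum (fun k => amp u k ^ 2) (‖u‖ ^ 2) := by
  rw [← real_inner_self_eq_norm_sq]
  exact (hasSum_coeff_mul_conj u u).congr_fun fun k => (sum_re_mul_conj_self u k).symm

theorem amp_sub_sq_le (u v : VField d) (k : Fin d → ℤ) :
    amp (u - v) k ^ 2 ≤ 2 * amp u k ^ 2 + 2 * amp v k ^ 2 := by
  simp only [amp_sq, Finset.mul_sum, ← Finset.sum_add_distrib, coeff_sub]
  refine Finset.sum_le_sum fun i _ => ?_
  have h := norm_sub_le (coeff u i k) (coeff v i k)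
  nlinarith [norm_nonneg (coeff u i k - coeff v i k), sq_nonneg (‖coeff u i k‖ - ‖coeff v i k‖)]

theorem vInner_self (s : ℝ) (u : VField d) :
    vInner s u u = ∑' k : Fin d → ℤ, waveNumber k ^ (2 * s) * amp u k ^ 2 := by
  unfold vInner
  simp_rw [← sum_re_mul_conj_self]

theorem vInner_self_nonneg (s : ℝ) (u : VField d) : 0 ≤ vInner s u u := by
  rw [vInner_self]
  exact tsum_nonneg fun k => mul_nonneg (Real.rpow_nonneg (waveNumber_nonneg k) _) (sq_nonneg _)

theorem vNorm_sq (s : ℝ) (u : VField d) :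
    vNorm s u ^ 2 = ∑' k : Fin d → ℤ, waveNumber k ^ (2 * s) * amp u k ^ 2 := by
  rw [← vInner_self]
  exact Real.sq_sqrt (vInner_self_nonneg s u)

theorem vNorm_nonneg (s : ℝ) (u : VField d) : 0 ≤ vNorm s u := Real.sqrt_nonneg _

theorem vNorm_zero (u : VField d) : vNorm 0 u = ‖u‖ := by
  have h : vNorm 0 u ^ 2 = ‖u‖ ^ 2 := by
    rw [vNorm_sq, ← (hasSum_amp_sq u).tsum_eq]
    simp
  exact (sq_eq_sq₀ (vNorm_nonneg 0 u) (norm_nonneg u)).1 h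

/-! ### The spaces `H` and `V^s` -/

theorem spaceH_induction {p : VField d → Prop} (h0 : p 0)
    (hadd : ∀ u v, p u → p v → p (u + v)) (hsmul : ∀ (c : ℝ) u, p u → p (c • u))
    (hcl : IsClosed {u | p u}) (htest : ∀ u ∈ testFields d, p u) {u : VField d}
    (hu : u ∈ spaceH d) : p u := by
  refine closure_minimal (fun v hv => ?_) hcl hu
  exact Submodule.span_induction (p := fun v _ => p v) htest h0 (fun _ _ _ _ => hadd _ _)
    (fun c _ _ => hsmul c _) hv

theorem coeff_zero_field (i : Fin d) (k : Fin d → ℤ) : coeff (0 : VField d) i k = 0 := by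
  simp [coeff_eq_hat, hat]

theorem coeff_zero_of_mem_spaceH {u : VField d} (hu : u ∈ spaceH d) (i : Fin d) :
    coeff u i 0 = 0 := by
  refine spaceH_induction (p := fun u => coeff u i 0 = 0) (coeff_zero_field _ _)
    (fun u v h1 h2 => ?_) (fun c u h => ?_) ?_ (fun u h => h.2.2 i) hu
  · rw [coeff_add, h1, h2, add_zero]
  · rw [coeff_smul, h, mul_zero]
  · exact isClosed_eq (continuous_coeff i 0) continuous_const

theorem sum_mul_coeff_of_mem_spaceH {u : VField d} (hu : u ∈ spaceH d) (k : Fin d → ℤ) :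
    ∑ i, (k i : ℂ) * coeff u i k = 0 := by
  refine spaceH_induction (p := fun u => ∑ i, (k i : ℂ) * coeff u i k = 0)
    (by simp [coeff_zero_field]) (fun u v h1 h2 => ?_) (fun c u h => ?_) ?_ (fun u h => h.2.1 k) hu
  · simp only [coeff_add, mul_add, Finset.sum_add_distrib, h1, h2, add_zero]
  · simp only [coeff_smul, mul_left_comm _ (c : ℂ), ← Finset.mul_sum, h, mul_zero]
  · exact isClosed_eq (continuous_finsetSum _ fun i _ => continuous_const.mul (continuous_coeff i k))
      continuous_const

theorem amp_zero_of_mem_spaceH {u : VField d} (hu : u ∈ spaceH d) : amp u 0 = 0 := by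
  simp [amp, coeff_zero_of_mem_spaceH hu]

theorem mem_spaceV {s : ℝ} {u : VField d} : u ∈ spaceV d s ↔ u ∈ spaceH d ∧
    Summable fun k : Fin d → ℤ => waveNumber k ^ (2 * s) * amp u k ^ 2 := by
  simp only [amp_sq]; rfl

theorem sub_mem_spaceV {s : ℝ} {u v : VField d} (hu : u ∈ spaceV d s) (hv : v ∈ spaceV d s) :
    u - v ∈ spaceV d s := by
  rw [mem_spaceV] at *
  refine ⟨sub_mem hu.1 hv.1, Summable.of_nonneg_of_le
    (fun k => mul_nonneg (Real.rpow_nonneg (waveNumber_nonneg k) _) (sq_nonneg _)) (fun k => ?_)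
    ((hu.2.mul_left 2).add (hv.2.mul_left 2))⟩
  have := mul_le_mul_of_nonneg_left (amp_sub_sq_le u v k)
    (Real.rpow_nonneg (waveNumber_nonneg k) (2 * s))
  linarith

theorem rpow_waveNumber_mul_amp_le {r s : ℝ} (hrs : r ≤ s) {u : VField d} (hu : u ∈ spaceH d)
    (k : Fin d → ℤ) :
    waveNumber k ^ (2 * r) * amp u k ^ 2 ≤ waveNumber k ^ (2 * s) * amp u k ^ 2 := by
  rcases eq_or_ne k 0 with rfl | hk
  · simp [amp_zero_of_mem_spaceH hu]
  · exact mul_le_mul_of_nonneg_right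
      (Real.rpow_le_rpow_of_exponent_le (one_le_waveNumber hk) (by linarith)) (sq_nonneg _)

theorem spaceV_mono {r s : ℝ} (hrs : r ≤ s) {u : VField d} (hu : u ∈ spaceV d s) :
    u ∈ spaceV d r := by
  rw [mem_spaceV] at *
  exact ⟨hu.1, Summable.of_nonneg_of_le
    (fun k => mul_nonneg (Real.rpow_nonneg (waveNumber_nonneg k) _) (sq_nonneg _))
    (rpow_waveNumber_mul_amp_le hrs hu.1) hu.2⟩

/-- The Poincaré inequality. -/
theorem vNorm_mono {r s : ℝ} (hrs : r ≤ s) {u : VField d} (hu : u ∈ spaceV d s) :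
    vNorm r u ≤ vNorm s u := by
  refine Real.sqrt_le_sqrt ?_
  rw [vInner_self, vInner_self]
  exact (mem_spaceV.1 (spaceV_mono hrs hu)).2.tsum_le_tsum
    (rpow_waveNumber_mul_amp_le hrs hu.1) (mem_spaceV.1 hu).2

theorem norm_le_vNorm {s : ℝ} (hs : 0 ≤ s) {u : VField d} (hu : u ∈ spaceV d s) :
    ‖u‖ ≤ vNorm s u := by
  rw [← vNorm_zero]; exact vNorm_mono hs hu

theorem vNorm_sub_sq_le {s : ℝ} {u v : VField d} (hu : u ∈ spaceV d s) (hv : v ∈ spaceV d s) :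
    vNorm s (u - v) ^ 2 ≤ 2 * vNorm s u ^ 2 + 2 * vNorm s v ^ 2 := by
  have hw := (mem_spaceV.1 (sub_mem_spaceV hu hv)).2
  have hu' := (mem_spaceV.1 hu).2.mul_left 2
  have hv' := (mem_spaceV.1 hv).2.mul_left 2
  rw [vNorm_sq, vNorm_sq, vNorm_sq, ← tsum_mul_left, ← tsum_mul_left, ← hu'.tsum_add hv']
  refine hw.tsum_le_tsum (fun k => ?_) (hu'.add hv')
  have := mul_le_mul_of_nonneg_left (amp_sub_sq_le u v k)
    (Real.rpow_nonneg (waveNumber_nonneg k) (2 * s))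
  linarith

/-! ### The trilinear form on the Fourier side -/

theorem norm_mFourier_apply (k : Fin d → ℤ) (x : UnitAddTorus (Fin d)) :
    ‖UnitAddTorus.mFourier k x‖ = 1 := by
  simp only [UnitAddTorus.mFourier, fourier_apply, ContinuousMap.coe_mk, norm_prod]
  exact Finset.prod_eq_one fun i _ => Circle.norm_coe _

theorem integrable_mul (g h : Lp ℂ 2 (torusMeasure d)) :
    Integrable (fun x => g x * h x) (torusMeasure d) :=
  (Lp.memLp g).integrable_mul (Lp.memLp h)

/-- Parseval's identity for `e_k g` and a real valued `h`. -/
theorem hasSum_hat_mul_conj_hat_add (k : Fin d → ℤ) (g h : Lp ℂ 2 (torusMeasure d))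
    (hh : ∀ᵐ x ∂torusMeasure d, conj (h x) = h x) :
    HasSum (fun j => hat g j * conj (hat h (k + j)))
      (∫ x, UnitAddTorus.mFourier k x * (g x * h x) ∂torusMeasure d) := by
  have hmem : MemLp (fun x => UnitAddTorus.mFourier (-k) x * h x) 2 (torusMeasure d) := by
    refine (Lp.memLp h).of_le ?_ (Filter.Eventually.of_forall fun x => ?_)
    · exact (UnitAddTorus.mFourier (-k)).continuous.aestronglyMeasurable.mul
        (Lp.aestronglyMeasurable h)
    · rw [norm_mul, norm_mFourier_apply, one_mul]
  have hcoe := hmem.coeFn_toLp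
  have h1 : ∀ j, hat (hmem.toLp _) j = hat h (k + j) := fun j => by
    rw [hat_eq_integral, hat_eq_integral]
    refine integral_congr_ae ?_
    filter_upwards [hcoe] with x hx
    rw [hx, ← mul_assoc, ← UnitAddTorus.mFourier_add, neg_add, add_comm (-k)]
  have h2 := hasSum_hat_mul_conj (hmem.toLp _) g
  simp only [h1] at h2
  convert! h2 using 1
  rw [L2.inner_def]
  refine integral_congr_ae ?_
  filter_upwards [hcoe, hh] with x hx hx'
  rw [hx, RCLike.inner_apply, map_mul, hx', ← UnitAddTorus.mFourier_neg, neg_neg]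
  ring

/-- A function with absolutely summable Fourier coefficients is the uniform sum of its Fourier
series. -/
theorem exists_continuous_ae_eq {f : Lp ℂ 2 (torusMeasure d)} (hf : Summable fun k => ‖hat f k‖) :
    ∃ F : C(UnitAddTorus (Fin d), ℂ), (f =ᵐ[torusMeasure d] F) ∧
      HasSum (fun k => hat f k • UnitAddTorus.mFourier k) F := by
  have hs : Summable fun k => hat f k • (UnitAddTorus.mFourier k : C(UnitAddTorus (Fin d), ℂ)) :=
    Summable.of_norm (by simpa [norm_smul, UnitAddTorus.mFourier_norm] using hf)
  refine ⟨_, ?_, hs.hasSum⟩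
  have h1 := (ContinuousMap.toLp (E := ℂ) 2 (torusMeasure d) ℂ).hasSum hs.hasSum
  have h2 : f = ContinuousMap.toLp (E := ℂ) 2 (torusMeasure d) ℂ
      (∑' k, hat f k • UnitAddTorus.mFourier k) := by
    refine (hasSum_hat_smul f).unique (h1.congr_fun fun k => ?_)
    rw [basis_apply, map_smul]
    rfl
  conv_lhs => rw [h2]
  exact ContinuousMap.coeFn_toLp (torusMeasure d) _

theorem integrable_mul_mul {f : Lp ℂ 2 (torusMeasure d)} (hf : Summable fun k => ‖hat f k‖)
    (g h : Lp ℂ 2 (torusMeasure d)) :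
    Integrable (fun x => f x * (g x * h x)) (torusMeasure d) := by
  obtain ⟨F, hF, -⟩ := exists_continuous_ae_eq hf
  refine (integrable_mul g h).bdd_mul (c := ‖F‖) (Lp.aestronglyMeasurable f) ?_
  filter_upwards [hF] with x hx
  rw [hx]
  exact F.norm_coe_le_norm x

theorem summable_hat_mul_hat_mul {f : Lp ℂ 2 (torusMeasure d)} (hf : Summable fun k => ‖hat f k‖)
    (g h : Lp ℂ 2 (torusMeasure d)) :
    Summable fun p : (Fin d → ℤ) × (Fin d → ℤ) =>
      hat f p.1 * (hat g p.2 * conj (hat h (p.1 + p.2))) := by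
  refine Summable.of_norm ?_
  simpa only [norm_mul, RCLike.norm_conj, mul_assoc] using
    (summable_and_tsum_conv_le_of_summable (fun k => norm_nonneg (hat f k))
      (fun k => norm_nonneg (hat g k)) (fun k => norm_nonneg (hat h k)) hf
      (hasSum_norm_hat_sq g).summable (hasSum_norm_hat_sq h).summable).1

/-- The integral of a product of three functions as a convolution of Fourier coefficients. -/
theorem hasSum_hat_mul_hat_mul {f : Lp ℂ 2 (torusMeasure d)} (hf : Summable fun k => ‖hat f k‖)
    (g h : Lp ℂ 2 (torusMeasure d)) (hh : ∀ᵐ x ∂torusMeasure d, conj (h x) = h x) :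
    HasSum (fun p : (Fin d → ℤ) × (Fin d → ℤ) => hat f p.1 * (hat g p.2 * conj (hat h (p.1 + p.2))))
      (∫ x, f x * (g x * h x) ∂torusMeasure d) := by
  have h1 := (summable_hat_mul_hat_mul hf g h).hasSum
  have h2 := h1.prod_fiberwise fun k => (hasSum_hat_mul_conj_hat_add k g h hh).mul_left (hat f k)
  have h3 : HasSum (fun k => hat f k * ∫ x, UnitAddTorus.mFourier k x * (g x * h x) ∂torusMeasure d)
      (∫ x, f x * (g x * h x) ∂torusMeasure d) := by
    obtain ⟨F, hF, hsum⟩ := exists_continuous_ae_eq hf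
    have hn : ∀ k x, ‖hat f k * (UnitAddTorus.mFourier k x * (g x * h x))‖ =
        ‖hat f k‖ * ‖g x * h x‖ := fun k x => by
      rw [norm_mul, norm_mul, norm_mFourier_apply, one_mul]
    have hint : ∀ k, Integrable
        (fun x => hat f k * (UnitAddTorus.mFourier k x * (g x * h x))) (torusMeasure d) := fun k =>
      ((integrable_mul g h).bdd_mul (c := 1)
        (UnitAddTorus.mFourier k).continuous.aestronglyMeasurable
        (Filter.Eventually.of_forall fun x => (norm_mFourier_apply k x).le)).const_mul _
    have h4 := hasSum_integral_of_summable_integral_norm hint (by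
      simp only [hn, integral_const_mul]
      exact hf.mul_right _)
    simp only [integral_const_mul] at h4
    convert! h4 using 1
    refine integral_congr_ae ?_
    filter_upwards [hF] with x hx
    have h5 := (ContinuousMap.evalCLM ℂ x).hasSum hsum
    have h6 := h5.mul_right (g x * h x)
    rw [hx]
    refine (h6.congr_fun fun k => ?_).tsum_eq.symm
    simp [mul_assoc]
  rw [← h2.unique h3]
  exact h1

theorem summable_norm_coeff {u : VField d} (hu : Summable (amp u)) (i : Fin d) :
    Summable fun k => ‖hat (comp i u) k‖ := by
  simp only [← coeff_eq_hat]
  exact Summable.of_nonneg_of_le (fun _ => norm_nonneg _) (fun k => norm_coeff_le_amp u i k) hu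

/-- The symbol of `∂_i` at the wave vector `k`. -/
def derivSymbol (i : Fin d) (k : Fin d → ℤ) : ℂ := 2 * (Real.pi : ℂ) * Complex.I * (k i : ℂ)

theorem norm_derivSymbol_mul_coeff_le (i j : Fin d) (v : VField d) (k : Fin d → ℤ) :
    ‖derivSymbol i k * coeff v j k‖ ≤ 2 * Real.pi * (waveNumber k * amp v k) := by
  have h1 : ‖derivSymbol i k‖ = 2 * Real.pi * |(k i : ℝ)| := by
    simp [derivSymbol, abs_of_pos Real.pi_pos]
  rw [norm_mul, h1, mul_assoc]
  have := mul_le_mul (abs_le_waveNumber k i) (norm_coeff_le_amp v j k) (norm_nonneg _)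
    (waveNumber_nonneg k)
  gcongr

theorem summable_waveNumber_mul_amp_sq {v : VField d} (hv : v ∈ spaceV d 1) :
    Summable fun k => (waveNumber k * amp v k) ^ 2 := by
  refine (mem_spaceV.1 hv).2.congr fun k => ?_
  rw [mul_pow, mul_one]
  norm_cast

theorem tsum_waveNumber_mul_amp_sq (v : VField d) :
    ∑' k, (waveNumber k * amp v k) ^ 2 = vNorm 1 v ^ 2 := by
  rw [vNorm_sq]
  refine tsum_congr fun k => ?_
  rw [mul_pow, mul_one]
  norm_cast

theorem hat_partialDeriv {v : VField d} (hv : v ∈ spaceV d 1) (i j : Fin d) (k : Fin d → ℤ) :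
    hat (partialDeriv i j v) k = derivSymbol i k * coeff v j k := by
  have hmem : Memℓp (fun k => derivSymbol i k * coeff v j k) 2 := by
    refine memℓp_gen ?_
    refine Summable.of_nonneg_of_le (fun k => by positivity) (fun k => ?_)
      ((summable_waveNumber_mul_amp_sq hv).mul_left ((2 * Real.pi) ^ 2))
    rw [← mul_pow]
    have := norm_derivSymbol_mul_coeff_le i j v k
    simp only [ENNReal.toReal_ofNat, Real.rpow_ofNat]
    gcongr
  have h1 := (basis d).hasSum_repr_symm ⟨_, hmem⟩
  have h2 : partialDeriv i j v = (basis d).repr.symm ⟨_, hmem⟩ := by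
    rw [← h1.tsum_eq]
    refine tsum_congr fun k => ?_
    rw [basis_apply]
    rfl
  rw [hat, h2, LinearIsometryEquiv.apply_symm_apply]

/-- The summand of `b(u, v, w) = ∑_{k,j} (û(k) · 2πi j) (v̂(j) · conj ŵ(k + j))`. -/
def triTerm (u v w : VField d) (p : (Fin d → ℤ) × (Fin d → ℤ)) : ℂ :=
  ∑ i, ∑ j, coeff u i p.1 * (derivSymbol i p.2 * coeff v j p.2 * conj (coeff w j (p.1 + p.2)))

theorem triForm_eq_re_tsum {u v : VField d} (hu : Summable (amp u)) (hv : v ∈ spaceV d 1)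
    (w : VField d) :
    Summable (triTerm u v w) ∧ triForm u v w = (∑' p, triTerm u v w p).re := by
  have h : HasSum (triTerm u v w) (∑ i, ∑ j,
      ∫ x, comp i u x * (partialDeriv i j v x * comp j w x) ∂torusMeasure d) := by
    refine hasSum_sum fun i _ => hasSum_sum fun j _ => ?_
    simp only [coeff_eq_hat u, coeff_eq_hat w, ← hat_partialDeriv hv]
    exact hasSum_hat_mul_hat_mul (summable_norm_coeff hu i) _ _ (conj_comp j w)
  refine ⟨h.summable, ?_⟩
  rw [h.tsum_eq, triForm]
  congr 1
  have hint := fun i j => integrable_mul_mul (summable_norm_coeff hu i) (partialDeriv i j v)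
    (comp j w)
  simp_rw [← integral_finsetSum Finset.univ fun j _ => hint _ j]
  rw [← integral_finsetSum _ fun i _ => integrable_finsetSum _ fun j _ => hint i j]
  refine integral_congr_ae ?_
  filter_upwards [ae_all_iff.2 fun i => coeFn_comp i u, ae_all_iff.2 fun i => coeFn_comp i w] with
    x hx hy
  simp only [hx, hy, mul_assoc]

theorem triTerm_eq (u v w : VField d) (p : (Fin d → ℤ) × (Fin d → ℤ)) :
    triTerm u v w p = (∑ i, coeff u i p.1 * derivSymbol i p.2) *
      ∑ j, coeff v j p.2 * conj (coeff w j (p.1 + p.2)) := by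
  simp only [triTerm, Finset.sum_mul_sum, mul_assoc]

theorem norm_triTerm_le (u v w : VField d) (p : (Fin d → ℤ) × (Fin d → ℤ)) :
    ‖triTerm u v w p‖ ≤ amp u p.1 * (waveNumber p.2 * amp v p.2) * amp w (p.1 + p.2) := by
  have h1 : ‖∑ i, coeff u i p.1 * derivSymbol i p.2‖ ≤ amp u p.1 * waveNumber p.2 := by
    have h : ∀ i, ‖derivSymbol i p.2‖ = 2 * Real.pi * |(p.2 i : ℝ)| := fun i => by
      simp [derivSymbol, abs_of_pos Real.pi_pos]
    calc ‖∑ i, coeff u i p.1 * derivSymbol i p.2‖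
        ≤ ∑ i, ‖coeff u i p.1‖ * (2 * Real.pi * |(p.2 i : ℝ)|) := by
          refine (norm_sum_le _ _).trans_eq (Finset.sum_congr rfl fun i _ => ?_)
          rw [norm_mul, h]
      _ = 2 * Real.pi * ∑ i, ‖coeff u i p.1‖ * |(p.2 i : ℝ)| := by
          rw [Finset.mul_sum]; exact Finset.sum_congr rfl fun i _ => by ring
      _ ≤ 2 * Real.pi * (amp u p.1 * √(∑ i, |(p.2 i : ℝ)| ^ 2)) := by
          gcongr; exact Real.sum_mul_le_sqrt_mul_sqrt _ _ _
      _ = amp u p.1 * waveNumber p.2 := by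
          simp only [sq_abs, waveNumber]; ring
  have h2 : ‖∑ j, coeff v j p.2 * conj (coeff w j (p.1 + p.2))‖ ≤ amp v p.2 * amp w (p.1 + p.2) := by
    refine (norm_sum_le _ _).trans ?_
    simp only [norm_mul, RCLike.norm_conj]
    exact Real.sum_mul_le_sqrt_mul_sqrt _ _ _
  rw [triTerm_eq, norm_mul]
  refine (mul_le_mul h1 h2 (norm_nonneg _)
    (mul_nonneg (amp_nonneg _ _) (waveNumber_nonneg _))).trans_eq ?_
  ring

theorem abs_triForm_le_tsum {u v : VField d} (hu : Summable (amp u)) (hv : v ∈ spaceV d 1)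
    (w : VField d)
    (hs : Summable fun p : (Fin d → ℤ) × (Fin d → ℤ) =>
      amp u p.1 * (waveNumber p.2 * amp v p.2) * amp w (p.1 + p.2)) :
    |triForm u v w| ≤ ∑' p : (Fin d → ℤ) × (Fin d → ℤ),
      amp u p.1 * (waveNumber p.2 * amp v p.2) * amp w (p.1 + p.2) := by
  rw [(triForm_eq_re_tsum hu hv w).2]
  exact (Complex.abs_re_le_norm _).trans (tsum_of_norm_bounded hs.hasSum (norm_triTerm_le u v w))

/-- The form `b(u, v, ·)` is bounded on `L²`. -/
theorem abs_triForm_le {u v : VField d} (hu : Summable (amp u)) (hv : v ∈ spaceV d 1)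
    (w : VField d) : |triForm u v w| ≤ (∑' k, amp u k) * vNorm 1 v * ‖w‖ := by
  have h := summable_and_tsum_conv_le_of_summable (amp_nonneg u)
    (fun k => mul_nonneg (waveNumber_nonneg k) (amp_nonneg v k)) (amp_nonneg w) hu
    (summable_waveNumber_mul_amp_sq hv) (hasSum_amp_sq w).summable
  refine (abs_triForm_le_tsum hu hv w h.1).trans (h.2.trans_eq ?_)
  rw [tsum_waveNumber_mul_amp_sq, (hasSum_amp_sq w).tsum_eq, Real.sqrt_sq (vNorm_nonneg _ _),
    Real.sqrt_sq (norm_nonneg _), mul_assoc]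

theorem triForm_add_right {u v : VField d} (hu : Summable (amp u)) (hv : v ∈ spaceV d 1)
    (w z : VField d) : triForm u v (w + z) = triForm u v w + triForm u v z := by
  obtain ⟨hs1, h1⟩ := triForm_eq_re_tsum hu hv w
  obtain ⟨hs2, h2⟩ := triForm_eq_re_tsum hu hv z
  rw [h1, h2, (triForm_eq_re_tsum hu hv (w + z)).2, ← Complex.add_re, ← hs1.tsum_add hs2]
  congr 1
  refine tsum_congr fun p => ?_
  simp only [triTerm_eq, coeff_add, map_add, mul_add, Finset.sum_add_distrib]

theorem triForm_smul_right {u v : VField d} (hu : Summable (amp u)) (hv : v ∈ spaceV d 1)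
    (c : ℝ) (w : VField d) : triForm u v (c • w) = c * triForm u v w := by
  rw [(triForm_eq_re_tsum hu hv w).2, (triForm_eq_re_tsum hu hv (c • w)).2,
    ← Complex.re_ofReal_mul, ← tsum_mul_left]
  congr 1
  refine tsum_congr fun p => ?_
  simp only [triTerm_eq, coeff_smul, map_mul, Complex.conj_ofReal, mul_left_comm _ (c : ℂ),
    ← Finset.mul_sum]

theorem triForm_sub_left {u v z : VField d} (hu : Summable (amp u)) (hz : Summable (amp z))
    (huz : Summable (amp (u - z))) (hv : v ∈ spaceV d 1) (w : VField d) :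
    triForm (u - z) v w = triForm u v w - triForm z v w := by
  obtain ⟨hs1, h1⟩ := triForm_eq_re_tsum hu hv w
  obtain ⟨hs2, h2⟩ := triForm_eq_re_tsum hz hv w
  rw [h1, h2, (triForm_eq_re_tsum huz hv w).2, ← Complex.sub_re, ← hs1.tsum_sub hs2]
  congr 1
  refine tsum_congr fun p => ?_
  simp only [triTerm_eq, coeff_sub, sub_mul, Finset.sum_sub_distrib]

theorem triForm_sub_middle {u v z : VField d} (hu : Summable (amp u)) (hv : v ∈ spaceV d 1)
    (hz : z ∈ spaceV d 1) (w : VField d) :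
    triForm u (v - z) w = triForm u v w - triForm u z w := by
  obtain ⟨hs1, h1⟩ := triForm_eq_re_tsum hu hv w
  obtain ⟨hs2, h2⟩ := triForm_eq_re_tsum hu hz w
  rw [h1, h2, (triForm_eq_re_tsum hu (sub_mem_spaceV hv hz) w).2, ← Complex.sub_re,
    ← hs1.tsum_sub hs2]
  congr 1
  refine tsum_congr fun p => ?_
  simp only [triTerm_eq, coeff_sub, sub_mul, mul_sub, Finset.sum_sub_distrib]

/-- For divergence free `u`, the involution `(k, j) ↦ (-k, k + j)` of the frequencies turns the
summands of `b(u, w, w)` into the negatives of their conjugates. -/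
theorem triForm_self_eq_zero {u w : VField d} (hu : Summable (amp u)) (huH : u ∈ spaceH d)
    (hw : w ∈ spaceV d 1) : triForm u w w = 0 := by
  have hflip : ∀ p, triTerm u w w (flipEquiv (Fin d → ℤ) p) = -conj (triTerm u w w p) := by
    rintro ⟨k, j⟩
    have h1 : ∑ i, coeff u i (-k) * derivSymbol i (k + j) =
        -conj (∑ i, coeff u i k * derivSymbol i j) := by
      have hdiv := congrArg conj (sum_mul_coeff_of_mem_spaceH huH k)
      simp only [map_sum, map_mul, map_zero, map_intCast] at hdiv
      have h2 : ∀ i, coeff u i (-k) * derivSymbol i (k + j) =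
          2 * (Real.pi : ℂ) * Complex.I * ((k i : ℂ) * conj (coeff u i k)) -
            conj (coeff u i k * derivSymbol i j) := fun i => by
        rw [coeff_neg_freq]
        simp only [derivSymbol, Pi.add_apply, map_mul, Complex.conj_I, Complex.conj_ofReal,
          map_intCast, map_ofNat]
        push_cast
        ring
      simp only [h2, Finset.sum_sub_distrib, ← Finset.mul_sum, hdiv, map_sum]
      ring
    simp only [flipEquiv, Equiv.coe_fn_mk, triTerm_eq, neg_add_cancel_left, h1]
    simp only [map_mul, map_sum, Complex.conj_conj, neg_mul]
    congr 2
    exact Finset.sum_congr rfl fun i _ => mul_comm _ _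
  have h := triForm_eq_re_tsum hu hw w
  have h3 : ∑' p, triTerm u w w p = -conj (∑' p, triTerm u w w p) := by
    rw [Complex.conj_tsum, ← tsum_neg, ← tsum_congr hflip]
    exact ((flipEquiv (Fin d → ℤ)).tsum_eq (triTerm u w w)).symm
  have h4 := congrArg Complex.re h3
  rw [Complex.neg_re, Complex.conj_re] at h4
  rw [h.2]
  linarith

/-! ### Estimates in `V^s` -/

/-- `V^{2α}` embeds into the fields with absolutely summable Fourier coefficients when
`4α > d`. -/
theorem exists_tsum_amp_le (hd : 0 < d) {α : ℝ} (hα : (d : ℝ) < 4 * α) :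
    ∃ K : ℝ, 0 < K ∧ ∀ u ∈ spaceV d (2 * α),
      Summable (amp u) ∧ ∑' k, amp u k ≤ K * vNorm (2 * α) u := by
  obtain ⟨S, hS0, hS⟩ := exists_tsum_weight_le hd hα
  obtain ⟨hs, hle⟩ := hS 1 le_rfl
  have hα0 : 0 ≤ 2 * α := by
    have : (0 : ℝ) ≤ d := Nat.cast_nonneg d
    linarith
  refine ⟨2 * √S, by positivity, fun u hu => ?_⟩
  have hw1 : ∀ k : Fin d → ℤ, 1 ≤ weight α 1 k := one_le_weight α zero_le_one
  have hpt : ∀ k, (weight α 1 k * amp u k) ^ 2 ≤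
      2 * amp u k ^ 2 + 2 * (waveNumber k ^ (2 * (2 * α)) * amp u k ^ 2) := fun k => by
    have h2 : waveNumber k ^ (2 * (2 * α)) = (waveNumber k ^ (2 * α)) ^ 2 := by
      rw [← Real.rpow_natCast, ← Real.rpow_mul (waveNumber_nonneg k)]
      congr 1; push_cast; ring
    rw [h2, weight, div_one]
    nlinarith [mul_nonneg (sq_nonneg (amp u k)) (sq_nonneg (1 - waveNumber k ^ (2 * α)))]
  have hbs := ((hasSum_amp_sq u).summable.mul_left 2).add ((mem_spaceV.1 hu).2.mul_left 2)
  have hfs : Summable fun k => (weight α 1 k * amp u k) ^ 2 :=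
    Summable.of_nonneg_of_le (fun _ => sq_nonneg _) hpt hbs
  have hft : ∑' k, (weight α 1 k * amp u k) ^ 2 ≤ (2 * vNorm (2 * α) u) ^ 2 := by
    refine (hfs.tsum_le_tsum hpt hbs).trans ?_
    rw [((hasSum_amp_sq u).summable.mul_left 2).tsum_add ((mem_spaceV.1 hu).2.mul_left 2),
      tsum_mul_left, tsum_mul_left, (hasSum_amp_sq u).tsum_eq, ← vNorm_sq]
    nlinarith [norm_le_vNorm hα0 hu, norm_nonneg u]
  have hcs := summable_mul_and_tsum_mul_le_sqrt_mul_sqrt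
    (f := fun k => weight α 1 k * amp u k) (g := fun k => (weight α 1 k)⁻¹)
    (fun k => mul_nonneg (zero_le_one.trans (hw1 k)) (amp_nonneg u k))
    (fun k => inv_nonneg.2 (zero_le_one.trans (hw1 k))) hfs (by simpa only [inv_pow] using hs)
  have heq : (fun k => weight α 1 k * amp u k * (weight α 1 k)⁻¹) = amp u := by
    funext k
    have := (zero_lt_one.trans_le (hw1 k)).ne'
    field_simp
  rw [heq] at hcs
  refine ⟨hcs.1, hcs.2.trans ?_⟩
  have h1 := (Real.sqrt_le_sqrt hft).trans_eq
    (Real.sqrt_sq (mul_nonneg zero_le_two (vNorm_nonneg _ u)))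
  have h2 : √(∑' k : Fin d → ℤ, (weight α 1 k)⁻¹ ^ 2) ≤ √S := by
    refine Real.sqrt_le_sqrt ?_
    simpa using hle
  calc _ ≤ 2 * vNorm (2 * α) u * √S :=
        mul_le_mul h1 h2 (Real.sqrt_nonneg _) (mul_nonneg zero_le_two (vNorm_nonneg _ u))
    _ = _ := by ring

/-- The trilinear estimate behind `‖w‖_{L⁴}² ≤ C ‖w‖^{2θ} ‖w‖_{V^α}^{2(1-θ)}`, with the frequency
`R` at which low and high modes are separated kept as a free parameter. -/
theorem exists_abs_triForm_le (hd : 0 < d) {α : ℝ} (hα : (d : ℝ) < 4 * α) :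
    ∃ C : ℝ, 0 < C ∧ ∀ R : ℝ, 1 ≤ R → ∀ u ∈ spaceV d 1, ∀ w ∈ spaceV d α, Summable (amp w) →
      |triForm w u w| ≤
        C * R ^ ((d : ℝ) / 2) * vNorm 1 u * (‖w‖ ^ 2 + R ^ (-(2 * α)) * vNorm α w ^ 2) := by
  obtain ⟨S, hS0, hS⟩ := exists_tsum_weight_le hd hα
  refine ⟨√S, by positivity, fun R hR u hu w hw hws => ?_⟩
  obtain ⟨hs, hle⟩ := hS R hR
  have hR0 : 0 < R := by linarith
  have hw0 : ∀ k : Fin d → ℤ, 0 < weight α R k := fun k =>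
    zero_lt_one.trans_le (one_le_weight α hR0.le k)
  have hB2 : ∀ k, (amp w k * √(weight α R k)) ^ 2 =
      amp w k ^ 2 + R ^ (-(2 * α)) * (waveNumber k ^ (2 * α) * amp w k ^ 2) := fun k => by
    rw [mul_pow, Real.sq_sqrt (hw0 k).le, weight, Real.div_rpow (waveNumber_nonneg k) hR0.le,
      Real.rpow_neg hR0.le]
    ring
  have hBs := (hasSum_amp_sq w).summable.add ((mem_spaceV.1 hw).2.mul_left (R ^ (-(2 * α))))
  have hBt : ∑' k, (amp w k * √(weight α R k)) ^ 2 =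
      ‖w‖ ^ 2 + R ^ (-(2 * α)) * vNorm α w ^ 2 := by
    rw [tsum_congr hB2, (hasSum_amp_sq w).summable.tsum_add ((mem_spaceV.1 hw).2.mul_left _),
      tsum_mul_left, (hasSum_amp_sq w).tsum_eq, ← vNorm_sq]
  have hn4 : ∀ k, (√(weight α R k))⁻¹ ^ 4 = (weight α R k ^ 2)⁻¹ := fun k => by
    rw [inv_pow, show 4 = 2 * 2 from rfl, pow_mul, Real.sq_sqrt (hw0 k).le]
  have hBn : ∀ k, amp w k * √(weight α R k) * (√(weight α R k))⁻¹ = amp w k := fun k => by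
    have := (Real.sqrt_pos.2 (hw0 k)).ne'
    field_simp
  have hconv := summable_and_tsum_conv_le (a := fun k => waveNumber k * amp u k)
    (B := fun k => amp w k * √(weight α R k)) (n := fun k => (√(weight α R k))⁻¹)
    (fun k => mul_nonneg (waveNumber_nonneg k) (amp_nonneg u k))
    (fun k => mul_nonneg (amp_nonneg w k) (Real.sqrt_nonneg _))
    (fun k => inv_nonneg.2 (Real.sqrt_nonneg _)) (summable_waveNumber_mul_amp_sq hu)
    (hBs.congr fun k => (hB2 k).symm) (hs.congr fun k => (hn4 k).symm)
  simp only [hBn, hBt, hn4] at hconv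
  refine (abs_triForm_le_tsum hws hu w hconv.1).trans (hconv.2.trans ?_)
  rw [tsum_waveNumber_mul_amp_sq, Real.sqrt_sq (vNorm_nonneg _ _)]
  have hsq : √(∑' k : Fin d → ℤ, (weight α R k ^ 2)⁻¹) ≤ √S * R ^ ((d : ℝ) / 2) := by
    refine (Real.sqrt_le_sqrt hle).trans_eq ?_
    rw [Real.sqrt_mul hS0.le]
    congr 1
    rw [Real.sqrt_eq_rpow, ← Real.rpow_natCast, ← Real.rpow_mul hR0.le]
    congr 1; ring
  calc _ ≤ (‖w‖ ^ 2 + R ^ (-(2 * α)) * vNorm α w ^ 2) *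
        (vNorm 1 u * (√S * R ^ ((d : ℝ) / 2))) := by
        have := vNorm_nonneg 1 u
        gcongr
    _ = _ := by ring

/-- The trilinear estimate with the top order term absorbed by the dissipation: `R` is chosen so
that the coefficient of `‖w‖_{V^α}²` is `ν/8`. If this would require `R < 1`, the term `‖w‖²` is
itself controlled by the dissipation through the Poincaré inequality. -/
theorem exists_abs_triForm_le_dissipation (hd : 0 < d) {α ν : ℝ} (hα : (d : ℝ) < 4 * α)
    (hν : 0 < ν) :
    ∃ C : ℝ, 0 < C ∧ ∀ u ∈ spaceV d 1, ∀ w ∈ spaceV d α, Summable (amp w) →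
      |triForm w u w| ≤ ν / 4 * vNorm α w ^ 2 +
        C * vNorm 1 u ^ (1 / (1 - (d : ℝ) / (4 * α))) * ‖w‖ ^ 2 := by
  obtain ⟨C, hC0, hC⟩ := exists_abs_triForm_le hd hα
  have hd' : (0 : ℝ) < d := by exact_mod_cast hd
  have hα0 : 0 < α := by linarith
  set θ := 1 - (d : ℝ) / (4 * α) with hθ
  have hθ0 : 0 < θ := by
    have : (d : ℝ) / (4 * α) < 1 := (div_lt_one (by linarith)).2 hα
    linarith
  have hθα : 2 * α * θ = 2 * α - d / 2 := by rw [hθ]; field_simp; ring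
  refine ⟨ν / 8 * (8 * C / ν) ^ (1 / θ), by positivity, fun u hu w hw hws => ?_⟩
  set U := vNorm 1 u with hU
  have hU0 : 0 ≤ U := vNorm_nonneg 1 u
  have hwα : ‖w‖ ^ 2 ≤ vNorm α w ^ 2 := by
    have := norm_le_vNorm hα0.le hw
    gcongr
  have hlast : 0 ≤ ν / 8 * (8 * C / ν) ^ (1 / θ) * U ^ (1 / θ) * ‖w‖ ^ 2 := by positivity
  have hqU : C * U = ν / 8 * (8 * C / ν * U) := by field_simp
  rcases le_total (8 * C / ν * U) 1 with hq | hq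
  · have h1 := hC 1 le_rfl u hu w hw hws
    rw [Real.one_rpow, Real.one_rpow, mul_one, one_mul] at h1
    have h2 : C * U ≤ ν / 8 := by rw [hqU]; nlinarith
    have h3 : C * U * (‖w‖ ^ 2 + vNorm α w ^ 2) ≤ ν / 8 * (vNorm α w ^ 2 + vNorm α w ^ 2) := by
      gcongr
    linarith
  · set q := 8 * C / ν * U with hqdef
    have hq0 : 0 < q := by linarith
    have he0 : 0 ≤ 1 / (2 * α * θ) := by positivity
    have h1 := hC (q ^ (1 / (2 * α * θ))) (Real.one_le_rpow hq he0) u hu w hw hws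
    rw [← Real.rpow_mul hq0.le, ← Real.rpow_mul hq0.le] at h1
    have h2 : q * q ^ (1 / (2 * α * θ) * ((d : ℝ) / 2)) = q ^ (1 / θ) := by
      nth_rewrite 1 [← Real.rpow_one q]
      rw [← Real.rpow_add hq0]
      congr 1
      have : (d : ℝ) / 2 = 2 * α - 2 * α * θ := by linarith
      rw [this]; field_simp; ring
    have h3 : q ^ (1 / θ) * q ^ (1 / (2 * α * θ) * -(2 * α)) = 1 := by
      rw [← Real.rpow_add hq0]
      have : 1 / θ + 1 / (2 * α * θ) * -(2 * α) = 0 := by field_simp; ring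
      rw [this, Real.rpow_zero]
    have h4 : q ^ (1 / θ) = (8 * C / ν) ^ (1 / θ) * U ^ (1 / θ) :=
      Real.mul_rpow (by positivity) hU0
    have h5 : C * q ^ (1 / (2 * α * θ) * ((d : ℝ) / 2)) * U = ν / 8 * q ^ (1 / θ) := by
      rw [← h2]; linear_combination q ^ (1 / (2 * α * θ) * ((d : ℝ) / 2)) * hqU
    rw [h5, mul_add, ← mul_assoc, mul_assoc (ν / 8) (q ^ (1 / θ)) (q ^ _), h3, mul_one, h4] at h1
    have h6 : 0 ≤ ν / 8 * vNorm α w ^ 2 := by positivity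
    calc |triForm w u w| ≤ _ := h1
      _ ≤ _ := by linarith

/-! ### The right-hand side of the equation as a functional on `L²` -/

theorem summable_vInner_and_abs_le {α : ℝ} {u : VField d} (hu : u ∈ spaceV d (2 * α))
    (w : VField d) :
    (Summable fun k : Fin d → ℤ =>
        waveNumber k ^ (2 * α) * ∑ i, (coeff u i k * conj (coeff w i k)).re) ∧
      |vInner α u w| ≤ vNorm (2 * α) u * ‖w‖ := by
  have hsq : ∀ k, (waveNumber k ^ (2 * α) * amp u k) ^ 2 =
      waveNumber k ^ (2 * (2 * α)) * amp u k ^ 2 := fun k => by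
    rw [mul_pow, ← Real.rpow_natCast (waveNumber k ^ (2 * α)),
      ← Real.rpow_mul (waveNumber_nonneg k)]
    congr 2; push_cast; ring
  have hcs := summable_mul_and_tsum_mul_le_sqrt_mul_sqrt
    (f := fun k => waveNumber k ^ (2 * α) * amp u k) (g := amp w)
    (fun k => mul_nonneg (Real.rpow_nonneg (waveNumber_nonneg k) _) (amp_nonneg u k))
    (amp_nonneg w) ((mem_spaceV.1 hu).2.congr fun k => (hsq k).symm) (hasSum_amp_sq w).summable
  rw [tsum_congr hsq, ← vNorm_sq, (hasSum_amp_sq w).tsum_eq, Real.sqrt_sq (vNorm_nonneg _ _),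
    Real.sqrt_sq (norm_nonneg _)] at hcs
  have hpt : ∀ k, ‖waveNumber k ^ (2 * α) * ∑ i, (coeff u i k * conj (coeff w i k)).re‖ ≤
      waveNumber k ^ (2 * α) * amp u k * amp w k := fun k => by
    have h0 := Real.rpow_nonneg (waveNumber_nonneg k) (2 * α)
    rw [norm_mul, Real.norm_of_nonneg h0, mul_assoc]
    refine mul_le_mul_of_nonneg_left ((norm_sum_le _ _).trans ?_) h0
    refine le_trans (Finset.sum_le_sum fun i _ => ?_) (Real.sum_mul_le_sqrt_mul_sqrt _ _ _)
    refine (Complex.abs_re_le_norm _).trans_eq ?_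
    rw [norm_mul, RCLike.norm_conj]
  exact ⟨Summable.of_norm_bounded hcs.1 hpt,
    (tsum_of_norm_bounded hcs.1.hasSum hpt).trans hcs.2⟩

theorem vInner_add_right {α : ℝ} {u : VField d} (hu : u ∈ spaceV d (2 * α)) (w z : VField d) :
    vInner α u (w + z) = vInner α u w + vInner α u z := by
  unfold vInner
  rw [← (summable_vInner_and_abs_le hu w).1.tsum_add (summable_vInner_and_abs_le hu z).1]
  refine tsum_congr fun k => ?_
  simp only [coeff_add, map_add, mul_add, Complex.add_re, Finset.sum_add_distrib]

theorem vInner_smul_right (α c : ℝ) (u w : VField d) :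
    vInner α u (c • w) = c * vInner α u w := by
  unfold vInner
  rw [← tsum_mul_left]
  refine tsum_congr fun k => ?_
  simp only [coeff_smul, map_mul, Complex.conj_ofReal, mul_left_comm _ (c : ℂ),
    Complex.re_ofReal_mul, ← Finset.mul_sum]
  ring

theorem vInner_sub_left {α : ℝ} {u v : VField d} (hu : u ∈ spaceV d (2 * α))
    (hv : v ∈ spaceV d (2 * α)) (w : VField d) :
    vInner α (u - v) w = vInner α u w - vInner α v w := by
  unfold vInner
  rw [← (summable_vInner_and_abs_le hu w).1.tsum_sub (summable_vInner_and_abs_le hv w).1]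
  refine tsum_congr fun k => ?_
  simp only [coeff_sub, sub_mul, mul_sub, Complex.sub_re, Finset.sum_sub_distrib]

/-- For `u ∈ V^{2α}` the time derivative prescribed by the equation is a bounded functional on all
of `L²`, not only on test fields. -/
theorem exists_clm_rhs (hd : 0 < d) {α ν : ℝ} (hα : (d : ℝ) < 4 * α) (hα' : 1 ≤ 2 * α)
    (hν : 0 < ν) :
    ∃ K : ℝ, 0 < K ∧ ∀ g : VField d, ∀ u ∈ spaceV d (2 * α), ∃ F : VField d →L[ℝ] ℝ,
      (∀ φ, F φ = inner ℝ g φ - triForm u u φ - ν * vInner α u φ) ∧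
        ‖F‖ ≤ ‖g‖ + K * vNorm (2 * α) u ^ 2 + ν * vNorm (2 * α) u := by
  obtain ⟨K, hK0, hK⟩ := exists_tsum_amp_le hd hα
  refine ⟨K, hK0, fun g u hu => ?_⟩
  obtain ⟨hs, hle⟩ := hK u hu
  have hu1 := spaceV_mono hα' hu
  have hN := vNorm_nonneg (2 * α) u
  let L : VField d →ₗ[ℝ] ℝ :=
    { toFun := fun φ => inner ℝ g φ - triForm u u φ - ν * vInner α u φ
      map_add' := fun φ ψ => by
        rw [inner_add_right, triForm_add_right hs hu1, vInner_add_right hu]; ring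
      map_smul' := fun c φ => by
        rw [inner_smul_right, triForm_smul_right hs hu1, vInner_smul_right]
        simp only [RingHom.id_apply, smul_eq_mul]; ring }
  have hb : ∀ φ, ‖L φ‖ ≤ (‖g‖ + K * vNorm (2 * α) u ^ 2 + ν * vNorm (2 * α) u) * ‖φ‖ := fun φ => by
    have h1 : |inner ℝ g φ| ≤ ‖g‖ * ‖φ‖ := abs_real_inner_le_norm g φ
    have h2 : |triForm u u φ| ≤ K * vNorm (2 * α) u ^ 2 * ‖φ‖ := by
      refine (abs_triForm_le hs hu1 φ).trans (mul_le_mul_of_nonneg_right ?_ (norm_nonneg _))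
      calc (∑' k, amp u k) * vNorm 1 u ≤ K * vNorm (2 * α) u * vNorm (2 * α) u :=
            mul_le_mul hle (vNorm_mono hα' hu) (vNorm_nonneg _ _) (by positivity)
        _ = _ := by ring
    have h3 : |ν * vInner α u φ| ≤ ν * (vNorm (2 * α) u * ‖φ‖) := by
      rw [abs_mul, abs_of_pos hν]
      exact mul_le_mul_of_nonneg_left (summable_vInner_and_abs_le hu φ).2 hν.le
    change |inner ℝ g φ - triForm u u φ - ν * vInner α u φ| ≤ _
    refine (abs_sub _ _).trans ?_
    have := abs_sub (inner ℝ g φ) (triForm u u φ)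
    linarith
  exact ⟨L.mkContinuous _ hb, fun φ => rfl, L.mkContinuous_norm_le (by positivity) hb⟩

/-! ### The energy identity for weakly differentiable curves, and exponential decay -/

section WeakDerivative

variable {E : Type*} [NormedAddCommGroup E] [InnerProductSpace ℝ E]

theorem hasDerivWithinAt_inner_of_mem_span {S : Set E} {w : ℝ → E} {F : E →L[ℝ] ℝ} {s : Set ℝ}
    {t : ℝ} (hder : ∀ φ ∈ S, HasDerivWithinAt (fun τ => inner ℝ (w τ) φ) (F φ) s t) {φ : E}
    (hφ : φ ∈ Submodule.span ℝ S) : HasDerivWithinAt (fun τ => inner ℝ (w τ) φ) (F φ) s t := by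
  induction hφ using Submodule.span_induction with
  | mem φ h => exact hder φ h
  | zero => simpa using hasDerivWithinAt_const t s (0 : ℝ)
  | add φ ψ _ _ h1 h2 => simpa only [inner_add_right, map_add] using h1.fun_add h2
  | smul c φ _ h => simpa only [inner_smul_right, map_smul, smul_eq_mul] using h.const_mul c

/-- A curve whose pairings with a total set have uniformly bounded derivatives is Lipschitz. -/
theorem norm_sub_le_of_weak_deriv_bound {S : Set E} {w : ℝ → E} {F : ℝ → E →L[ℝ] ℝ} {t₀ T M : ℝ}
    (hw : ∀ t, t₀ ≤ t → w t ∈ (Submodule.span ℝ S).topologicalClosure)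
    (hder : ∀ φ ∈ S, ∀ t, t₀ ≤ t →
      HasDerivWithinAt (fun τ => inner ℝ (w τ) φ) (F t φ) (Set.Ici t₀) t)
    (hM : ∀ t ∈ Set.Icc t₀ T, ‖F t‖ ≤ M) {a b : ℝ} (ha : a ∈ Set.Icc t₀ T)
    (hb : b ∈ Set.Icc t₀ T) : ‖w b - w a‖ ≤ M * |b - a| := by
  have h1 : ∀ φ ∈ Submodule.span ℝ S, |inner ℝ (w b - w a) φ| ≤ M * |b - a| * ‖φ‖ := fun φ hφ => by
    have := (convex_Icc t₀ T).norm_image_sub_le_of_norm_hasDerivWithin_le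
      (f := fun τ => inner ℝ (w τ) φ) (f' := fun t => F t φ) (C := M * ‖φ‖)
      (fun t ht => (hasDerivWithinAt_inner_of_mem_span (fun ψ hψ => hder ψ hψ t ht.1) hφ).mono
        Set.Icc_subset_Ici_self)
      (fun t ht => ((F t).le_opNorm φ).trans
        (mul_le_mul_of_nonneg_right (hM t ht) (norm_nonneg φ))) ha hb
    rw [inner_sub_left]
    refine this.trans_eq ?_
    rw [Real.norm_eq_abs]; ring
  have h2 : ∀ φ ∈ (Submodule.span ℝ S).topologicalClosure,
      |inner ℝ (w b - w a) φ| ≤ M * |b - a| * ‖φ‖ := fun φ hφ =>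
    closure_minimal (t := {φ | |inner ℝ (w b - w a) φ| ≤ M * |b - a| * ‖φ‖}) h1
      (isClosed_le (by fun_prop) (by fun_prop)) hφ
  have h3 := h2 _ (sub_mem (hw b hb.1) (hw a ha.1))
  rw [real_inner_self_eq_norm_sq, abs_of_nonneg (sq_nonneg _), sq] at h3
  have hM0 : 0 ≤ M := (norm_nonneg _).trans (hM a ha)
  rcases (norm_nonneg (w b - w a)).eq_or_lt with h | h
  · rw [← h]; positivity
  · exact le_of_mul_le_mul_right h3 h

/-- If `w` has the weak derivative `F`, tested against a total set, and `F` is locally bounded,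
then `‖w‖²` is differentiable with derivative `2 F(w)`. No continuity of `F` in time and no strong
differentiability of `w` is needed: `w` is Lipschitz, so that the quadratic remainder
`‖w(τ) - w(t)‖²` is negligible. -/
theorem hasDerivWithinAt_norm_sq_of_weak_deriv {S : Set E} {w : ℝ → E} {F : ℝ → E →L[ℝ] ℝ}
    {t₀ : ℝ} (hw : ∀ t, t₀ ≤ t → w t ∈ (Submodule.span ℝ S).topologicalClosure)
    (hder : ∀ φ ∈ S, ∀ t, t₀ ≤ t →
      HasDerivWithinAt (fun τ => inner ℝ (w τ) φ) (F t φ) (Set.Ici t₀) t)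
    (hM : ∀ T, ∃ M, ∀ t ∈ Set.Icc t₀ T, ‖F t‖ ≤ M) {t : ℝ} (ht : t₀ ≤ t) :
    HasDerivWithinAt (fun τ => ‖w τ‖ ^ 2) (2 * F t (w t)) (Set.Ici t₀) t := by
  obtain ⟨M, hM⟩ := hM (t + 1)
  have htm : t ∈ Set.Icc t₀ (t + 1) := ⟨ht, by linarith⟩
  have hM0 : 0 ≤ M := (norm_nonneg _).trans (hM t htm)
  rw [hasDerivWithinAt_iff_isLittleO, Asymptotics.isLittleO_iff]
  intro c hc
  obtain ⟨φ, hφ, hdist⟩ := Metric.mem_closure_iff.1 (hw t ht) (c / (8 * (M + 1))) (by positivity)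
  rw [dist_eq_norm] at hdist
  have hφder := hasDerivWithinAt_inner_of_mem_span (fun ψ hψ => hder ψ hψ t ht) hφ
  rw [hasDerivWithinAt_iff_isLittleO, Asymptotics.isLittleO_iff] at hφder
  have hnhds : ∀ᶠ τ in nhdsWithin t (Set.Ici t₀), |τ - t| < min 1 (c / (4 * (M ^ 2 + 1))) := by
    refine nhdsWithin_le_nhds ?_
    exact Metric.ball_mem_nhds t (by positivity)
  filter_upwards [hφder (c := c / 8) (by positivity), hnhds, self_mem_nhdsWithin] with τ h1 h2 hτ
  have hτ1 : |τ - t| < 1 := h2.trans_le (min_le_left _ _)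
  have hτ2 : |τ - t| < c / (4 * (M ^ 2 + 1)) := h2.trans_le (min_le_right _ _)
  have hlip := norm_sub_le_of_weak_deriv_bound hw hder hM htm
    (b := τ) ⟨hτ, by linarith [(abs_lt.1 hτ1).2]⟩
  simp only [smul_eq_mul, Real.norm_eq_abs] at h1 ⊢
  have hid : ‖w τ‖ ^ 2 - ‖w t‖ ^ 2 - (τ - t) * (2 * F t (w t)) =
      2 * (inner ℝ (w τ) φ - inner ℝ (w t) φ - (τ - t) * F t φ) +
        2 * inner ℝ (w τ - w t) (w t - φ) - 2 * ((τ - t) * F t (w t - φ)) +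
        ‖w τ - w t‖ ^ 2 := by
    rw [norm_sub_sq_real, map_sub, inner_sub_left, inner_sub_right, inner_sub_right,
      real_inner_self_eq_norm_sq]
    ring
  have hτ0 := abs_nonneg (τ - t)
  have hδ : M * ‖w t - φ‖ ≤ c / 8 := by
    calc M * ‖w t - φ‖ ≤ (M + 1) * (c / (8 * (M + 1))) := by gcongr; linarith
      _ = c / 8 := by field_simp
  have hb1 : |inner ℝ (w τ - w t) (w t - φ)| ≤ c / 8 * |τ - t| := by
    refine (abs_real_inner_le_norm _ _).trans ?_
    calc ‖w τ - w t‖ * ‖w t - φ‖ ≤ M * |τ - t| * ‖w t - φ‖ := by gcongr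
      _ = M * ‖w t - φ‖ * |τ - t| := by ring
      _ ≤ c / 8 * |τ - t| := by gcongr
  have hb2 : |(τ - t) * F t (w t - φ)| ≤ c / 8 * |τ - t| := by
    rw [abs_mul, mul_comm]
    refine mul_le_mul_of_nonneg_right ?_ hτ0
    exact ((F t).le_of_opNorm_le (hM t htm) _).trans hδ
  have hb3 : ‖w τ - w t‖ ^ 2 ≤ c / 4 * |τ - t| := by
    calc ‖w τ - w t‖ ^ 2 ≤ (M * |τ - t|) ^ 2 := by gcongr
      _ = M ^ 2 * |τ - t| * |τ - t| := by ring
      _ ≤ (M ^ 2 + 1) * (c / (4 * (M ^ 2 + 1))) * |τ - t| := by gcongr; linarith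
      _ = c / 4 * |τ - t| := by field_simp
  rw [hid]
  have hn := sq_nonneg ‖w τ - w t‖
  rw [abs_le] at *
  constructor <;> nlinarith

end WeakDerivative

theorem le_mul_exp_of_hasDerivWithinAt_le {y y' : ℝ → ℝ} {c t₀ : ℝ}
    (hy : ∀ t, t₀ ≤ t → HasDerivWithinAt y (y' t) (Set.Ici t₀) t)
    (hle : ∀ t, t₀ ≤ t → y' t ≤ -c * y t) {t : ℝ} (ht : t₀ ≤ t) :
    y t ≤ y t₀ * Real.exp (-c * (t - t₀)) := by
  have hexp : ∀ t, HasDerivAt (fun τ => Real.exp (c * (τ - t₀))) (Real.exp (c * (t - t₀)) * c) t :=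
    fun t => by simpa using (((hasDerivAt_id t).sub_const t₀).const_mul c).exp
  have hz : ∀ t, t₀ ≤ t → HasDerivWithinAt (fun τ => y τ * Real.exp (c * (τ - t₀)))
      (y' t * Real.exp (c * (t - t₀)) + y t * (Real.exp (c * (t - t₀)) * c)) (Set.Ici t₀) t :=
    fun t ht => (hy t ht).mul (hexp t).hasDerivWithinAt
  have hanti : AntitoneOn (fun τ => y τ * Real.exp (c * (τ - t₀))) (Set.Ici t₀) := by
    refine antitoneOn_of_hasDerivWithinAt_nonpos (convex_Ici t₀)
      (fun t ht => (hz t ht).continuousWithinAt)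
      (fun t ht => (hz t (interior_subset ht)).mono interior_subset) fun t ht => ?_
    have := mul_le_mul_of_nonneg_right (hle t (interior_subset ht))
      (Real.exp_pos (c * (t - t₀))).le
    linarith
  have h := hanti (Set.mem_Ici.2 le_rfl) (Set.mem_Ici.2 ht) ht
  simp only [sub_self, mul_zero, Real.exp_zero, mul_one] at h
  rw [neg_mul, Real.exp_neg, ← div_eq_mul_inv, le_div_iff₀ (Real.exp_pos _)]
  exact h

/-! ### Synchronisation of the two solutions -/

theorem leray_apply_eq_add {d : ℕ} (x : VField d) {w : VField d} (hw : w ∈ spaceH d) :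
    leray d x = leray d (x - w) + w := by
  have : leray d w = w := Submodule.starProjection_eq_self_iff.2 hw
  rw [map_sub, this, sub_add_cancel]

/-- The interpolation hypothesis at `s = 0`, in the range of parameters where it is used. -/
theorem norm_leray_interpolation_sq_le {d : ℕ} {α ν μ h c₀ : ℝ} {I : VField d →ₗ[ℝ] VField d}
    (hI : IsInterpolant α h c₀ I) (hμ : 0 < μ) (hc : μ * h ^ 2 * c₀ ≤ ν) {w : VField d}
    (hw : w ∈ spaceV d α) : μ * ‖leray d (I w - w)‖ ^ 2 ≤ ν * vNorm α w ^ 2 := by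
  have h1 := (hI 0 le_rfl w (by rwa [zero_add])).2
  rw [vNorm_zero, zero_add] at h1
  calc μ * ‖leray d (I w - w)‖ ^ 2 ≤ μ * (c₀ * h ^ 2 * vNorm α w ^ 2) := by gcongr
    _ = μ * h ^ 2 * c₀ * vNorm α w ^ 2 := by ring
    _ ≤ ν * vNorm α w ^ 2 := by gcongr

/-- The difference of the nonlinear terms, tested with `u - v`, is `b(u - v, u, u - v)`. -/
theorem triForm_self_sub_triForm_self {d : ℕ} {u v : VField d} (hu : Summable (amp u))
    (hv : Summable (amp v)) (huv : Summable (amp (u - v))) (hu1 : u ∈ spaceV d 1)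
    (hv1 : v ∈ spaceV d 1) :
    triForm u u (u - v) - triForm v v (u - v) = triForm (u - v) u (u - v) := by
  have h1 := triForm_sub_left hu hv huv hu1 (u - v)
  have h2 := triForm_sub_middle hv hu1 hv1 (u - v)
  have h3 := triForm_self_eq_zero hv hv1.1 (sub_mem_spaceV hu1 hv1)
  linarith

/-- The rate of change of `‖u - v‖² / 2` is at most `-(ν/4) ‖u - v‖²`: the nudging term
dominates the part of the nonlinearity that the dissipation does not absorb. -/
theorem energy_rate_le {d : ℕ} {α ν μ h c₀ C : ℝ} (hα : 0 ≤ α) (hν : 0 < ν)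
    {I : VField d →ₗ[ℝ] VField d} (hI : IsInterpolant α h c₀ I) (hμ : 0 < μ)
    (hc : μ * h ^ 2 * c₀ ≤ ν) {u w : VField d} (hw : w ∈ spaceV d α)
    (hb : |triForm w u w| ≤ ν / 4 * vNorm α w ^ 2 + C * ‖w‖ ^ 2) (hC : 2 * C < μ) :
    -(μ * inner ℝ (leray d (I w)) w) - triForm w u w - ν * vInner α w w ≤ -(ν / 4) * ‖w‖ ^ 2 := by
  have hinner : inner ℝ (leray d (I w)) w = inner ℝ (leray d (I w - w)) w + ‖w‖ ^ 2 := by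
    rw [leray_apply_eq_add (I w) hw.1, inner_add_left, real_inner_self_eq_norm_sq]
  have hint := norm_leray_interpolation_sq_le hI hμ hc hw
  have hcs := (abs_le.1 (abs_real_inner_le_norm (leray d (I w - w)) w)).1
  have hyoung : ‖leray d (I w - w)‖ * ‖w‖ ≤ ‖leray d (I w - w)‖ ^ 2 / 2 + ‖w‖ ^ 2 / 2 := by
    nlinarith [sq_nonneg (‖leray d (I w - w)‖ - ‖w‖)]
  have hnudge : μ * (-(‖leray d (I w - w)‖ ^ 2 / 2) + ‖w‖ ^ 2 / 2) ≤
      μ * inner ℝ (leray d (I w)) w := by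
    refine mul_le_mul_of_nonneg_left ?_ hμ.le
    rw [hinner]; linarith
  have hself : vInner α w w = vNorm α w ^ 2 := (Real.sq_sqrt (vInner_self_nonneg α w)).symm
  have hpoincare : ν * ‖w‖ ^ 2 ≤ ν * vNorm α w ^ 2 := by
    have := norm_le_vNorm hα hw
    gcongr
  have hCw : 2 * C * ‖w‖ ^ 2 ≤ μ * ‖w‖ ^ 2 := by gcongr
  have hb' := (abs_le.1 hb).1
  rw [hself]
  linarith

end FracNSE

end

open FracNSE

theorem mainTheorem1 (d : ℕ) (hd₂ : 2 ≤ d) (hd₈ : d ≤ 8) (α ν : ℝ)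
    (hα : (d : ℝ) / 4 + 1 / 2 ≤ α) (hν : 0 < ν) :
    ∃ C : ℝ, 0 < C ∧
      ∀ (μ h c₀ t₀ : ℝ) (I : VField d →ₗ[ℝ] VField d) (f u₀ v₀ : VField d)
        (u v : ℝ → VField d),
        0 < μ → 0 < h →
        IsInterpolant α h c₀ I →
        f ∈ spaceH d → u₀ ∈ spaceV d (2 * α) → v₀ ∈ spaceV d (2 * α) →
        IsClassicalSolution α ν t₀ (fun _ => f) u₀ u →
        IsClassicalSolution α ν t₀ (fun t => f + μ • leray d (I (u t - v t))) v₀ v →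
        (∀ t, t₀ ≤ t → 2 * C * vNorm 1 (u t) ^ (1 / (1 - (d : ℝ) / (4 * α))) < μ) →
        μ * h ^ 2 * c₀ ≤ ν →
        ∃ K lam : ℝ, 0 < lam ∧
          ∀ t, t₀ ≤ t → ‖u t - v t‖ ≤ K * Real.exp (-lam * (t - t₀)) := by
  have hd : 0 < d := by omega
  have hd' : (2 : ℝ) ≤ d := by exact_mod_cast hd₂
  have hdα : (d : ℝ) < 4 * α := by linarith
  have hα1 : 1 ≤ 2 * α := by linarith
  have hα0 : 0 ≤ α := by linarith
  obtain ⟨C, hC0, hC⟩ := exists_abs_triForm_le_dissipation hd hdα hν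
  obtain ⟨K, -, hK⟩ := exists_tsum_amp_le hd hdα
  obtain ⟨K', hK'0, hK'⟩ := exists_clm_rhs hd hdα hα1 hν
  refine ⟨C, hC0, fun μ h c₀ t₀ I f u₀ v₀ u v hμ _ hI _ _ _ hu hv hμu hc => ?_⟩
  set g : ℝ → VField d := fun t => f + μ • leray d (I (u t - v t)) with hg
  have hw : ∀ t, t₀ ≤ t → u t - v t ∈ spaceV d (2 * α) := fun t ht =>
    sub_mem_spaceV (hu.mem t ht) (hv.mem t ht)
  choose! F hF hFle using fun (t : ℝ) (ht : t₀ ≤ t) => hK' f (u t) (hu.mem t ht)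
  choose! G hG hGle using fun (t : ℝ) (ht : t₀ ≤ t) => hK' (g t) (v t) (hv.mem t ht)
  have hder : ∀ φ ∈ testFields d, ∀ t, t₀ ≤ t →
      HasDerivWithinAt (fun τ => inner ℝ (u τ - v τ) φ) ((F t - G t) φ) (Set.Ici t₀) t := by
    intro φ hφ t ht
    have := (hu.equation φ hφ t ht).fun_sub (hv.equation φ hφ t ht)
    simpa only [sub_apply, hF t ht, hG t ht, inner_sub_left] using this
  have hbdd : ∀ T, ∃ M, ∀ t ∈ Set.Icc t₀ T, ‖F t - G t‖ ≤ M := by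
    intro T
    obtain ⟨Mu, hMu⟩ := hu.bounded T
    obtain ⟨Mv, hMv⟩ := hv.bounded T
    -- `W` bounds `‖u - v‖²_{V^{2α}}`, hence also `‖u - v‖²` and `‖u - v‖²_{V^α}`
    set W := 2 * Mu ^ 2 + 2 * Mv ^ 2 with hW
    refine ⟨(‖f‖ + K' * Mu ^ 2 + ν * Mu) +
      (‖f‖ + μ * ((1 + ν / μ * W) + (1 + W)) + K' * Mv ^ 2 + ν * Mv), fun t ht => ?_⟩
    have hut := hMu t ht
    have hvt := hMv t ht
    have hu0 := vNorm_nonneg (2 * α) (u t)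
    have hv0 := vNorm_nonneg (2 * α) (v t)
    have hwV := hw t ht.1
    have hwα : vNorm α (u t - v t) ≤ vNorm (2 * α) (u t - v t) := vNorm_mono (by linarith) hwV
    have hwn : ‖u t - v t‖ ≤ vNorm (2 * α) (u t - v t) := norm_le_vNorm (by linarith) hwV
    have hwW : vNorm (2 * α) (u t - v t) ^ 2 ≤ W := by
      refine (vNorm_sub_sq_le (hu.mem t ht.1) (hv.mem t ht.1)).trans ?_
      rw [hW]; gcongr
    have hαW : vNorm α (u t - v t) ^ 2 ≤ W := by
      have := vNorm_nonneg α (u t - v t)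
      exact le_trans (by gcongr) hwW
    have hnW : ‖u t - v t‖ ^ 2 ≤ W := le_trans (by gcongr) hwW
    have hint : ‖leray d (I (u t - v t) - (u t - v t))‖ ^ 2 ≤ ν / μ * W := by
      have := norm_leray_interpolation_sq_le hI hμ hc (spaceV_mono (by linarith) hwV)
      have h2 : ν * vNorm α (u t - v t) ^ 2 ≤ ν * W := by gcongr
      rw [div_mul_eq_mul_div, le_div_iff₀ hμ]
      linarith
    have hlin : ∀ x : ℝ, x ≤ 1 + x ^ 2 := fun x => by nlinarith [sq_nonneg (x - 1)]
    have hler : ‖leray d (I (u t - v t))‖ ≤ (1 + ν / μ * W) + (1 + W) := by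
      rw [leray_apply_eq_add (I (u t - v t)) hwV.1]
      refine (norm_add_le _ _).trans ?_
      have h1 := hlin ‖leray d (I (u t - v t) - (u t - v t))‖
      have h2 := hlin ‖u t - v t‖
      linarith
    have hgt : ‖g t‖ ≤ ‖f‖ + μ * ((1 + ν / μ * W) + (1 + W)) := by
      refine (norm_add_le _ _).trans ?_
      rw [norm_smul, Real.norm_of_nonneg hμ.le]
      gcongr
    have hFt : ‖F t‖ ≤ ‖f‖ + K' * Mu ^ 2 + ν * Mu := (hFle t ht.1).trans (by gcongr)
    have hGt : ‖G t‖ ≤ ‖f‖ + μ * ((1 + ν / μ * W) + (1 + W)) + K' * Mv ^ 2 + ν * Mv :=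
      (hGle t ht.1).trans (by gcongr)
    exact (norm_sub_le _ _).trans (add_le_add hFt hGt)
  have henergy : ∀ t, t₀ ≤ t → HasDerivWithinAt (fun τ => ‖u τ - v τ‖ ^ 2)
      (2 * (F t - G t) (u t - v t)) (Set.Ici t₀) t := fun t ht =>
    hasDerivWithinAt_norm_sq_of_weak_deriv (fun τ hτ => (hw τ hτ).1) hder hbdd ht
  have hrate : ∀ t, t₀ ≤ t →
      2 * (F t - G t) (u t - v t) ≤ -(ν / 2) * ‖u t - v t‖ ^ 2 := by
    intro t ht
    have hut := hu.mem t ht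
    have hvt := hv.mem t ht
    have hwα : u t - v t ∈ spaceV d α := spaceV_mono (by linarith) (hw t ht)
    have hws := (hK _ (hw t ht)).1
    have h1 := energy_rate_le hα0 hν hI hμ hc hwα
      (hC (u t) (spaceV_mono hα1 hut) _ hwα hws) (by simpa only [mul_assoc] using hμu t ht)
    have h2 := triForm_self_sub_triForm_self (hK _ hut).1 (hK _ hvt).1 hws
      (spaceV_mono hα1 hut) (spaceV_mono hα1 hvt)
    have h3 := vInner_sub_left hut hvt (u t - v t)
    have h4 : (F t - G t) (u t - v t) = -(μ * inner ℝ (leray d (I (u t - v t))) (u t - v t)) -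
        triForm (u t - v t) (u t) (u t - v t) - ν * vInner α (u t - v t) (u t - v t) := by
      rw [sub_apply, hF t ht, hG t ht, hg, inner_add_left,
        real_inner_smul_left, ← h2, h3]
      ring
    rw [h4]
    linarith
  refine ⟨‖u t₀ - v t₀‖, ν / 4, by positivity, fun t ht => ?_⟩
  have hdecay := le_mul_exp_of_hasDerivWithinAt_le henergy hrate ht
  refine le_of_sq_le_sq ?_ (by positivity)
  refine hdecay.trans_eq ?_
  rw [mul_pow, ← Real.exp_nat_mul]
  congr 2
  push_cast
  ring
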